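/- Let $d\ge 1$, let $\|\cdot\|_B$ be a norm on $\mathbb R^d$ with closed unit ball $B$, and let $\lambda$ denote Lebesgue measure on $\mathbb R^d$. For $D\subset\mathbb R^d$ let $$F^B(D)=\{f:D\to\mathbb R \;:\; |f(x)-f(y)|\le\|x-y\|_B \text{ for all } x,y\in D\},$$ and let $$e_n(D)=\inf_{x_1,\dots,x_n\in D}\ \sup\Big\{\int_D f\,d\lambda \;:\; f\in F^B(D),\ f(x_1)=\dots=f(x_n)=0\Big\}$$ be the optimal error for integrating functions from $F^B(D)$ by means of $n$ function values. Let $\Theta_B$ be the covering constant of $\mathbb R^d$ with respect to $B$, i.e. the infimum of the densities of all coverings of $\mathbb R^d$ by translates of $B$. (i) There is a constant $\xi_B$, depending only on the norm, such that for every bounded Jordan measurable set $D\subset\mathbb R^d$ with an interior point $$\lim_{n\to\infty}\frac{e_n(D)}{\xi_B\,\lambda(D)\,\big(\lambda(D)/\lambda(B)\big)^{1/d}\,n^{-1/d}}=1,$$ and $$\frac{d}{d+1}\le\xi_B\le\frac{d}{d+1}\,\Theta_B^{1/d}.$$ Moreover, if $d\ge2$, then $$\frac{d}{d+1}\,\Theta_B^{1/d}\le\frac{d}{d+1}\,\big(d\log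 d+d\log\log d+5d\big)^{1/d}.$$ (ii) For every $n\ge1$, $$\inf_D\ e_n(D)\cdot\lambda(D)^{-(d+1)/d}=\frac{d}{d+1}\,\lambda(B)^{-1/d}\,n^{-1/d},$$ where the infimum is over all bounded Jordan measurable sets $D\subset\mathbb R^d$ with an interior point. -/

import Mathlib

open MeasureTheory Filter Topology
open scoped ENNReal NNReal

noncomputable section

/-- Bounded Jordan measurable subsets of `ℝ^d`: bounded sets whose boundary is a Lebesgue null
set. -/
def IsJordanMeasurable {d : ℕ} (D : Set (Fin d → ℝ)) : Prop :=
  Bornology.IsBounded D ∧ volume (frontier D) = 0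

/-- The domains under consideration: bounded Jordan measurable sets with an interior point. -/
def IsJordanDomain {d : ℕ} (D : Set (Fin d → ℝ)) : Prop :=
  IsJordanMeasurable D ∧ (interior D).Nonempty

/-- The closed unit ball `B` of the norm `N` on `ℝ^d`. -/
def unitBall {d : ℕ} (N : Seminorm ℝ (Fin d → ℝ)) : Set (Fin d → ℝ) :=
  {x | N x ≤ 1}

/-- The class `F^B(D)` of all functions with `|f x - f y| ≤ N (x - y)` on `D`. Functions on `D` are
represented by functions on `ℝ^d`, of which only the values on `D` are ever used. -/
def lipClass {d : ℕ} (N : Seminorm ℝ (Fin d → ℝ)) (D : Set (Fin d → ℝ)) :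
    Set ((Fin d → ℝ) → ℝ) :=
  {f | ∀ x ∈ D, ∀ y ∈ D, |f x - f y| ≤ N (x - y)}

/-- The radius of the information `f ↦ (f (x₁), …, f (xₙ))` for the integration problem: the
supremum of `∫_D f` over all `f` in `F^B(D)` with `f (xᵢ) = 0` for all `i`. The function `0`
competes, so the supremum is nonnegative and truncation at `0` does not change it. -/
def radiusInt {d : ℕ} (N : Seminorm ℝ (Fin d → ℝ)) (D : Set (Fin d → ℝ)) {n : ℕ}
    (x : Fin n → D) : ℝ≥0∞ :=
  ⨆ f ∈ {f | f ∈ lipClass N D ∧ ∀ i, f (x i : Fin d → ℝ) = 0},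
    ENNReal.ofReal (∫ t in D, f t)

/-- The optimal error `e_n(F^B(D), INT, Λ^std)` for integration with `n` function values:
the infimum of the radius of information over all choices of `n` sample points in `D`. -/
def optErrInt {d : ℕ} (N : Seminorm ℝ (Fin d → ℝ)) (D : Set (Fin d → ℝ)) (n : ℕ) : ℝ≥0∞ :=
  ⨅ x : Fin n → D, radiusInt N D x

/-- The translates `x + B`, `x ∈ X`, cover `ℝ^d`. -/
def IsCoveringSet {d : ℕ} (N : Seminorm ℝ (Fin d → ℝ)) (X : Set (Fin d → ℝ)) : Prop :=
  ∀ y, ∃ x ∈ X, y - x ∈ unitBall N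

/-- The (lower) density of the system of translates `x + B`, `x ∈ X`: the lower limit, as
`R → ∞`, of the total volume of those translates with centre in the cube `[-R, R]^d`, divided by
the volume of the cube. -/
def systemDensity {d : ℕ} (N : Seminorm ℝ (Fin d → ℝ)) (X : Set (Fin d → ℝ)) : ℝ≥0∞ :=
  liminf (fun R : ℝ =>
    ((X ∩ Set.Icc (fun _ => -R) (fun _ => R)).encard : ℝ≥0∞) * volume (unitBall N) /
      volume (Set.Icc (fun _ => -R) (fun _ => R) : Set (Fin d → ℝ))) atTop

/-- The covering constant `Θ_B`: the least density of a covering of `ℝ^d` by translates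
of `B`. -/
def coveringConstant {d : ℕ} (N : Seminorm ℝ (Fin d → ℝ)) : ℝ≥0∞ :=
  ⨅ X ∈ {X | IsCoveringSet N X}, systemDensity N X

end

/-!
Only the distances to the nodes matter: the extremal function of the class that vanishes at given
nodes is the distance to the nearest node, so `optErrInt N D n` is the infimum of the integrals over
`D` of the distance, in the norm `N`, to at most `n` points of `D` (`optErrInt_eq_minCost`). The
theorem is thus about the asymptotics of optimal quantization. Write `λ` for the Lebesgue measure,
`B` for the unit ball and `e_n(A)` for this infimum `minCost N A n`.

*Bathtub bound.* The points of `D` within distance `s` of `n` nodes have measure at most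
`n s^d λ(B)`. Integrating over `s` shows that no set of given volume is cheaper than a disjoint
union of `n` equal balls (`le_minCost`), and such a union attains the bound. This gives the
infimum over all domains, and also the lower bound for `ξ`.

*Existence of the limit.* The quantity `e_n` is subadditive under unions, nodes being added
(`minCost_union_le`), and scales like a length to the power `d + 1`. The unit cube is a union of
`k^d` copies of itself scaled by `1 / k`, so that `n^{1/d} e_n` of the unit cube converges to its
infimum `κ` (`cubeConst`, `eventually_minCost_unitCube_le`). A bounded Jordan measurable set is
filled up by equal cubes; the small remainder costs little, since a maximal packing in it provides
nodes at distance `O(n^{-1/d})` (`exists_minCost_le_volume_mul`). This proves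
`limsup n^{1/d} e_n(D) ≤ κ λ(D)^{1+1/d}` (`eventually_minCost_le`). The matching lower bound needs
no further geometry: for a cube `Q ⊇ D` the bound `e_n(Q) ≥ κ λ(Q)^{1+1/d} n^{-1/d}` holds for every
`n`, and the upper bound for `Q \ D` together with subadditivity leaves the required amount for `D`
(`eventually_le_minCost`). Hence `ξ = κ λ(B)^{1/d}`.

*Upper bound for `ξ`.* If unit balls centred in a cube cover it, its Voronoi cells are star-shaped,
so that the part of the cube within distance `s ≤ 1` of the nodes has at least the proportion `s^d`
of its volume (`le_volume_distTo_le`). The bathtub argument in reverse bounds the cost of the cube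
by the number of balls, which for a thin covering is about `Θ_B` times the ratio of the volumes
(`cubeConst_le_of_systemDensity_lt`).

*Rogers' bound.* In a large cube, balls of radius `1 / (1 + η)` are chosen greedily, each covering
at least the average proportion of what is left; a maximal packing of balls of radius
`η / (1 + η)` in the uncovered part then supplies centres such that all unit balls together cover
the cube. Periodic repetition gives a covering of density close to `(1 + η)^d (1 + d log (1 / η))`
(`coveringConstant_le_of_lt_one`), and `η = 1 / (d log d)` is a good choice, with `η = 1 / 2` for
`d = 2`.
-/

/-! ### Comparison with the supremum norm, and volumes of balls -/

section Norm

open scoped Pointwise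

variable {d : ℕ} {N : Seminorm ℝ (Fin d → ℝ)}

theorem Seminorm.exists_le_mul_norm (N : Seminorm ℝ (Fin d → ℝ)) :
    ∃ C : ℝ, 0 < C ∧ ∀ x, N x ≤ C * ‖x‖ := by
  refine ⟨∑ i, N (Pi.single i 1) + 1,
    add_pos_of_nonneg_of_pos (Finset.sum_nonneg fun i _ => apply_nonneg N _) one_pos, fun x => ?_⟩
  have hx : x = ∑ i, x i • (Pi.single i (1 : ℝ) : Fin d → ℝ) := by
    simpa using (pi_eq_sum_univ' x)
  have h1 : N x ≤ ∑ i, |x i| * N (Pi.single i (1 : ℝ)) := by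
    conv_lhs => rw [hx]
    refine (Finset.le_sum_of_subadditive N (map_zero N).le (map_add_le_add N) _ _).trans
      (Finset.sum_le_sum fun i _ => ?_)
    rw [map_smul_eq_mul, Real.norm_eq_abs]
  have h2 : ∑ i, |x i| * N (Pi.single i (1 : ℝ)) ≤ ∑ i, ‖x‖ * N (Pi.single i (1 : ℝ)) :=
    Finset.sum_le_sum fun i _ =>
      mul_le_mul_of_nonneg_right (norm_le_pi_norm x i) (apply_nonneg N _)
  rw [← Finset.mul_sum] at h2
  nlinarith [norm_nonneg x]

theorem Seminorm.continuous_pi (N : Seminorm ℝ (Fin d → ℝ)) : Continuous N := by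
  obtain ⟨C, hC, h⟩ := N.exists_le_mul_norm
  refine (LipschitzWith.of_dist_le_mul (K := ⟨C, hC.le⟩) fun x y => ?_).continuous
  rw [Real.dist_eq, dist_eq_norm]
  exact (abs_sub_map_le_sub N x y).trans (h _)

theorem Seminorm.exists_norm_le_mul (hN : ∀ x, N x = 0 → x = 0) :
    ∃ C : ℝ, 0 < C ∧ ∀ x, ‖x‖ ≤ C * N x := by
  rcases (Metric.sphere (0 : Fin d → ℝ) 1).eq_empty_or_nonempty with he | hne
  · refine ⟨1, one_pos, fun x => ?_⟩
    have : x = 0 := by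
      by_contra hx
      have : ‖x‖⁻¹ • x ∈ Metric.sphere (0 : Fin d → ℝ) 1 := by
        simp [norm_smul, inv_mul_cancel₀ (norm_ne_zero_iff.2 hx)]
      simp [he] at this
    simp [this]
  · obtain ⟨y, hy, hmin⟩ := (isCompact_sphere (0 : Fin d → ℝ) 1).exists_isMinOn hne
      N.continuous_pi.continuousOn
    have hy0 : 0 < N y := by
      refine lt_of_le_of_ne (apply_nonneg N y) fun h => ?_
      have := hN y h.symm
      simp [this] at hy
    refine ⟨(N y)⁻¹, inv_pos.2 hy0, fun x => ?_⟩
    rcases eq_or_ne x 0 with rfl | hx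
    · simp
    have hx' : 0 < ‖x‖ := norm_pos_iff.2 hx
    have hm : ‖x‖⁻¹ • x ∈ Metric.sphere (0 : Fin d → ℝ) 1 := by
      simp [norm_smul, inv_mul_cancel₀ hx'.ne']
    have h1 : N y ≤ N (‖x‖⁻¹ • x) := hmin hm
    rw [map_smul_eq_mul, norm_inv, norm_norm, inv_mul_eq_div, le_div_iff₀ hx'] at h1
    rw [inv_mul_eq_div, le_div_iff₀ hy0]
    linarith

theorem unitBall_eq_closedBall (N : Seminorm ℝ (Fin d → ℝ)) :
    unitBall N = N.closedBall 0 1 := by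
  ext x; simp [unitBall]

theorem Seminorm.isClosed_closedBall_pi (N : Seminorm ℝ (Fin d → ℝ)) (x : Fin d → ℝ) (r : ℝ) :
    IsClosed (N.closedBall x r) := by
  have : N.closedBall x r = (fun y => N (y - x)) ⁻¹' Set.Iic r := by
    ext y; simp [Seminorm.mem_closedBall]
  rw [this]
  exact isClosed_Iic.preimage (N.continuous_pi.comp (continuous_id.sub continuous_const))

theorem Seminorm.closedBall_eq_image (N : Seminorm ℝ (Fin d → ℝ)) (x : Fin d → ℝ) {r : ℝ}
    (hr : 0 < r) : N.closedBall x r = (fun y => x + y) '' (r • unitBall N) := by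
  ext y
  simp only [Seminorm.mem_closedBall, Set.mem_image, Set.mem_smul_set, unitBall, Set.mem_ofPred_eq]
  constructor
  · intro h
    refine ⟨y - x, ⟨r⁻¹ • (y - x), ?_, ?_⟩, by abel⟩
    · rw [map_smul_eq_mul, norm_inv, Real.norm_of_nonneg hr.le, inv_mul_le_iff₀ hr]; simpa
    · rw [smul_inv_smul₀ hr.ne']
  · rintro ⟨_, ⟨z, hz, rfl⟩, rfl⟩
    rw [add_sub_cancel_left, map_smul_eq_mul, Real.norm_of_nonneg hr.le]
    nlinarith

theorem Seminorm.volume_closedBall (N : Seminorm ℝ (Fin d → ℝ)) (x : Fin d → ℝ) {r : ℝ}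
    (hr : 0 < r) : volume (N.closedBall x r) = ENNReal.ofReal (r ^ d) * volume (unitBall N) := by
  rw [N.closedBall_eq_image x hr, Set.image_add_left, measure_preimage_add,
    Measure.addHaar_smul_of_nonneg _ hr.le]
  simp

theorem volume_unitBall_pos (N : Seminorm ℝ (Fin d → ℝ)) : 0 < volume (unitBall N) := by
  have ho : IsOpen {x | N x < 1} := isOpen_Iio.preimage N.continuous_pi
  refine (ho.measure_pos volume ⟨0, by simp⟩).trans_le (measure_mono fun x hx => ?_)
  exact (show N x < 1 from hx).le

theorem Seminorm.isBounded_closedBall (hN : ∀ x, N x = 0 → x = 0) (x : Fin d → ℝ) (r : ℝ) :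
    Bornology.IsBounded (N.closedBall x r) := by
  obtain ⟨C, hC, h⟩ := Seminorm.exists_norm_le_mul hN
  refine (Metric.isBounded_closedBall (x := x) (r := C * r)).subset fun y hy => ?_
  rw [Metric.mem_closedBall, dist_eq_norm]
  rw [Seminorm.mem_closedBall] at hy
  exact (h _).trans (mul_le_mul_of_nonneg_left hy hC.le)

theorem volume_unitBall_lt_top (hN : ∀ x, N x = 0 → x = 0) : volume (unitBall N) < ∞ := by
  rw [unitBall_eq_closedBall]
  exact (Seminorm.isBounded_closedBall hN 0 1).measure_lt_top

theorem volume_Icc_cube {d : ℕ} {R : ℝ} :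
    volume (Set.Icc (fun _ => -R) (fun _ => R) : Set (Fin d → ℝ)) =
      ENNReal.ofReal (2 * R) ^ d := by
  rw [Real.volume_Icc_pi]
  simp only [Finset.prod_const, Finset.card_univ, Fintype.card_fin]
  congr 2; ring

theorem IsJordanMeasurable.nullMeasurableSet {D : Set (Fin d → ℝ)} (hD : IsJordanMeasurable D) :
    NullMeasurableSet D := by
  exact isOpen_interior.measurableSet.nullMeasurableSet.congr
    (interior_ae_eq_of_null_frontier hD.2)

end Norm

/-! ### The cost of a finite set of nodes and the optimal error -/

section Cost

variable {d : ℕ} {N : Seminorm ℝ (Fin d → ℝ)}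

noncomputable section

/-- The distance, in the norm `N`, from `t` to the finite set `S`; it is `∞` when `S = ∅`. -/
def distTo (N : Seminorm ℝ (Fin d → ℝ)) (S : Finset (Fin d → ℝ)) (t : Fin d → ℝ) : ℝ≥0∞ :=
  S.inf fun x => ENNReal.ofReal (N (t - x))

/-- The integral over `A` of the distance to `S`. For nonempty `S ⊆ A` this is the radius of the
information `f ↦ f|_S`. -/
def nodeCost (N : Seminorm ℝ (Fin d → ℝ)) (A : Set (Fin d → ℝ)) (S : Finset (Fin d → ℝ)) : ℝ≥0∞ :=
  ∫⁻ t in A, distTo N S t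

/-- The infimum of the costs of the sets of at most `n` nodes in `A`. The empty set of nodes is
allowed: its cost is `∞` if `A` has positive volume, and `0` for `A = ∅`, where `optErrInt` would
have no nodes to choose from. -/
def minCost (N : Seminorm ℝ (Fin d → ℝ)) (A : Set (Fin d → ℝ)) (n : ℕ) : ℝ≥0∞ :=
  ⨅ S ∈ {S : Finset (Fin d → ℝ) | ↑S ⊆ A ∧ S.card ≤ n}, nodeCost N A S

end

theorem distTo_le_of_mem {S : Finset (Fin d → ℝ)} {x : Fin d → ℝ} (hx : x ∈ S) (t : Fin d → ℝ) :
    distTo N S t ≤ ENNReal.ofReal (N (t - x)) :=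
  Finset.inf_le (f := fun x => ENNReal.ofReal (N (t - x))) hx

theorem distTo_anti {S T : Finset (Fin d → ℝ)} (h : S ⊆ T) (t : Fin d → ℝ) :
    distTo N T t ≤ distTo N S t := Finset.inf_mono h

theorem measurable_distTo (N : Seminorm ℝ (Fin d → ℝ)) (S : Finset (Fin d → ℝ)) :
    Measurable (distTo N S) := by
  have : distTo N S = fun t => ⨅ x ∈ S, ENNReal.ofReal (N (t - x)) := by
    ext t; rw [distTo, Finset.inf_eq_iInf]
  rw [this]
  refine Measurable.biInf _ S.countable_toSet fun x _ => ?_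
  exact (N.continuous_pi.comp (continuous_id.sub continuous_const)).measurable.ennreal_ofReal

theorem distTo_le_ofReal_iff {S : Finset (Fin d → ℝ)} {t : Fin d → ℝ} {r : ℝ} (hr : 0 ≤ r) :
    distTo N S t ≤ ENNReal.ofReal r ↔ ∃ x ∈ S, t ∈ N.closedBall x r := by
  rw [distTo, Finset.inf_le_iff ENNReal.ofReal_lt_top]
  simp [Seminorm.mem_closedBall, ENNReal.ofReal_le_ofReal_iff hr]

theorem minCost_le {A : Set (Fin d → ℝ)} {S : Finset (Fin d → ℝ)} {n : ℕ} (hS : ↑S ⊆ A)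
    (hn : S.card ≤ n) : minCost N A n ≤ nodeCost N A S :=
  iInf₂_le S ⟨hS, hn⟩

theorem minCost_anti (A : Set (Fin d → ℝ)) {m n : ℕ} (h : m ≤ n) :
    minCost N A n ≤ minCost N A m :=
  le_iInf₂ fun _ hS => minCost_le hS.1 (hS.2.trans h)

theorem exists_nodeCost_lt {A : Set (Fin d → ℝ)} {n : ℕ} {c : ℝ≥0∞} (h : minCost N A n < c) :
    ∃ S : Finset (Fin d → ℝ), ↑S ⊆ A ∧ S.card ≤ n ∧ nodeCost N A S < c := by
  simp only [minCost, iInf_lt_iff] at h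
  obtain ⟨S, hS, h⟩ := h
  exact ⟨S, hS.1, hS.2, h⟩

theorem minCost_union_le (A B : Set (Fin d → ℝ)) (m n : ℕ) :
    minCost N (A ∪ B) (m + n) ≤ minCost N A m + minCost N B n := by
  classical
  refine ENNReal.le_of_forall_pos_le_add fun ε hε hfin => ?_
  have hA : minCost N A m ≠ ∞ := fun h => by simp [h] at hfin
  have hB : minCost N B n ≠ ∞ := fun h => by simp [h] at hfin
  have hε' : ((ε / 2 : ℝ≥0) : ℝ≥0∞) ≠ 0 := by
    simpa using hε.ne'
  obtain ⟨S, hSA, hSm, hS⟩ := exists_nodeCost_lt (ENNReal.lt_add_right hA hε')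
  obtain ⟨T, hTB, hTn, hT⟩ := exists_nodeCost_lt (ENNReal.lt_add_right hB hε')
  have hST : (↑(S ∪ T) : Set (Fin d → ℝ)) ⊆ A ∪ B := by
    rw [Finset.coe_union]; exact Set.union_subset_union hSA hTB
  refine (minCost_le hST ((Finset.card_union_le S T).trans (add_le_add hSm hTn))).trans ?_
  calc nodeCost N (A ∪ B) (S ∪ T)
      ≤ (∫⁻ t in A, distTo N (S ∪ T) t) + ∫⁻ t in B, distTo N (S ∪ T) t :=
        lintegral_union_le _ _ _
    _ ≤ nodeCost N A S + nodeCost N B T := by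
        gcongr
        · exact lintegral_mono fun t => distTo_anti Finset.subset_union_left t
        · exact lintegral_mono fun t => distTo_anti Finset.subset_union_right t
    _ ≤ (minCost N A m + (ε / 2 : ℝ≥0)) + (minCost N B n + (ε / 2 : ℝ≥0)) :=
        add_le_add hS.le hT.le
    _ = minCost N A m + minCost N B n + ε := by
        rw [add_add_add_comm, ← ENNReal.coe_add, add_halves]

theorem minCost_empty (n : ℕ) : minCost N (∅ : Set (Fin d → ℝ)) n = 0 := by
  refine le_antisymm ((minCost_le (S := ∅) (by simp) (by simp)).trans ?_) zero_le
  simp [nodeCost]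

theorem minCost_biUnion_le {ι : Type*} (J : Finset ι) (A : ι → Set (Fin d → ℝ)) (n : ℕ) :
    minCost N (⋃ j ∈ J, A j) (J.card * n) ≤ ∑ j ∈ J, minCost N (A j) n := by
  classical
  induction J using Finset.induction_on with
  | empty => simp [minCost_empty]
  | insert j J hj ih =>
    rw [Finset.set_biUnion_insert, Finset.card_insert_of_notMem hj, Finset.sum_insert hj,
      add_mul, one_mul, add_comm]
    exact (minCost_union_le _ _ _ _).trans (add_le_add le_rfl ih)

theorem distTo_affine (a : Fin d → ℝ) {s : ℝ} (hs : 0 < s) (S : Finset (Fin d → ℝ))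
    [DecidableEq (Fin d → ℝ)] (t : Fin d → ℝ) :
    distTo N (S.image fun x => a + s • x) (a + s • t) = ENNReal.ofReal s * distTo N S t := by
  have hcomp : ∀ x, ENNReal.ofReal (N (a + s • t - (a + s • x))) =
      ENNReal.ofReal s * ENNReal.ofReal (N (t - x)) := fun x => by
    rw [add_sub_add_left_eq_sub, ← smul_sub, map_smul_eq_mul, Real.norm_of_nonneg hs.le,
      ENNReal.ofReal_mul hs.le]
  rw [distTo, Finset.inf_image, distTo, Finset.inf_eq_iInf, Finset.inf_eq_iInf,
    ENNReal.mul_iInf_of_ne (by positivity) ENNReal.ofReal_ne_top]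
  refine iInf_congr fun x => ?_
  rw [ENNReal.mul_iInf_of_ne (by positivity) ENNReal.ofReal_ne_top]
  exact iInf_congr fun _ => hcomp x

theorem minCost_affine_le {A : Set (Fin d → ℝ)} (hA : MeasurableSet A) (a : Fin d → ℝ) {s : ℝ}
    (hs : 0 < s) (n : ℕ) :
    minCost N ((fun x => a + s • x) '' A) n ≤ ENNReal.ofReal (s ^ (d + 1)) * minCost N A n := by
  classical
  rw [minCost, minCost, ENNReal.mul_iInf_of_ne (by positivity) ENNReal.ofReal_ne_top]
  refine le_iInf fun S => ?_
  rw [ENNReal.mul_iInf_of_ne (by positivity) ENNReal.ofReal_ne_top]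
  refine le_iInf fun hS => ?_
  have hS' : ((S.image fun x => a + s • x : Finset _) : Set (Fin d → ℝ)) ⊆
      (fun x => a + s • x) '' A := by
    rw [Finset.coe_image]; exact Set.image_mono hS.1
  refine (iInf₂_le (S.image fun x => a + s • x) ⟨hS', Finset.card_image_le.trans hS.2⟩).trans ?_
  have hder : ∀ x ∈ A, HasFDerivWithinAt (fun x : Fin d → ℝ => a + s • x)
      (s • ContinuousLinearMap.id ℝ (Fin d → ℝ)) A x := fun x _ =>
    (((hasFDerivAt_id x).const_smul s).const_add a).hasFDerivWithinAt
  have hinj : Set.InjOn (fun x : Fin d → ℝ => a + s • x) A := fun x _ y _ h =>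
    smul_right_injective _ hs.ne' (add_left_cancel h)
  have hdet : (s • ContinuousLinearMap.id ℝ (Fin d → ℝ)).det = s ^ d := by
    rw [ContinuousLinearMap.det, ContinuousLinearMap.toLinearMap_smul, LinearMap.det_smul]
    simp
  rw [nodeCost, lintegral_image_eq_lintegral_abs_det_fderiv_mul volume hA hder hinj, hdet,
    abs_of_pos (pow_pos hs d), nodeCost]
  simp only [distTo_affine a hs]
  rw [← lintegral_const_mul _ (measurable_distTo N S)]
  refine lintegral_mono fun t => ?_
  rw [← mul_assoc, ← ENNReal.ofReal_mul (by positivity), pow_succ]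

end Cost

/-! ### Layer-cake estimates -/

section LayerCake

theorem lintegral_one_sub_pow (d : ℕ) {ρ : ℝ} (hρ : 0 < ρ) :
    ∫⁻ t in Set.Ioc 0 ρ, ENNReal.ofReal (1 - (t / ρ) ^ d) =
      ENNReal.ofReal ((d : ℝ) / (d + 1) * ρ) := by
  have hcont : Continuous fun t : ℝ => 1 - (t / ρ) ^ d := by fun_prop
  have hint : IntegrableOn (fun t : ℝ => 1 - (t / ρ) ^ d) (Set.Ioc 0 ρ) :=
    (hcont.integrableOn_Icc (a := 0) (b := ρ)).mono_set Set.Ioc_subset_Icc_self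
  have hnn : 0 ≤ᵐ[volume.restrict (Set.Ioc 0 ρ)] fun t : ℝ => 1 - (t / ρ) ^ d := by
    filter_upwards [ae_restrict_mem measurableSet_Ioc] with t ht
    have h1 : (t / ρ) ^ d ≤ 1 := pow_le_one₀ (div_nonneg ht.1.le hρ.le) ((div_le_one hρ).2 ht.2)
    simpa using h1
  rw [← ofReal_integral_eq_lintegral_ofReal hint hnn, ← intervalIntegral.integral_of_le hρ.le]
  congr 1
  rw [intervalIntegral.integral_sub (by simp) ((by fun_prop : Continuous fun t : ℝ =>
    (t / ρ) ^ d).intervalIntegrable _ _),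
    intervalIntegral.integral_comp_div (fun t => t ^ d) hρ.ne']
  simp only [intervalIntegral.integral_const, integral_pow, zero_div, div_self hρ.ne']
  have : (d : ℝ) + 1 ≠ 0 := by positivity
  simp
  field_simp
  ring

variable {α : Type*} [MeasurableSpace α] {μ : Measure α} {f : α → ℝ≥0∞} {d : ℕ} {ρ : ℝ}

theorem lintegral_eq_lintegral_meas_ofReal_lt (hf : Measurable f) (hfin : ∀ a, f a ≠ ∞) :
    ∫⁻ a, f a ∂μ = ∫⁻ t in Set.Ioi (0 : ℝ), μ {a | ENNReal.ofReal t < f a} := by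
  have h := lintegral_eq_lintegral_meas_lt μ (f := fun a => (f a).toReal)
    (Eventually.of_forall fun a => ENNReal.toReal_nonneg) hf.ennreal_toReal.aemeasurable
  simp only [ENNReal.ofReal_toReal (hfin _)] at h
  rw [h]
  refine setLIntegral_congr_fun measurableSet_Ioi fun t ht => ?_
  simp only [ENNReal.ofReal_lt_iff_lt_toReal (le_of_lt ht) (hfin _)]

/-- If the sublevel sets of `f` are at most as large as those of the distance to the centre of a
ball of radius `ρ` and of the same total mass, then so is the integral at least as large. -/
theorem le_lintegral_of_meas_sublevel_le [IsFiniteMeasure μ] (hf : Measurable f)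
    (hfin : ∀ a, f a ≠ ∞) (hρ : 0 < ρ)
    (h : ∀ s, 0 < s → s ≤ ρ →
      μ {a | f a ≤ ENNReal.ofReal s} ≤ ENNReal.ofReal ((s / ρ) ^ d) * μ Set.univ) :
    ENNReal.ofReal ((d : ℝ) / (d + 1) * ρ) * μ Set.univ ≤ ∫⁻ a, f a ∂μ := by
  rw [lintegral_eq_lintegral_meas_ofReal_lt hf hfin, ← lintegral_one_sub_pow d hρ,
    ← lintegral_mul_const _ (by fun_prop)]
  refine le_trans (setLIntegral_mono_ae' measurableSet_Ioc (Eventually.of_forall fun t ht => ?_))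
    (lintegral_mono_set fun _ ht => ht.1)
  have hc : {a | ENNReal.ofReal t < f a} = {a | f a ≤ ENNReal.ofReal t}ᶜ := by
    ext a; simp
  rw [hc, measure_compl (measurableSet_le hf measurable_const) (measure_ne_top _ _),
    ENNReal.ofReal_sub _ (pow_nonneg (div_nonneg ht.1.le hρ.le) d), ENNReal.ofReal_one,
    ENNReal.sub_mul (fun _ _ => measure_ne_top _ _), one_mul]
  exact tsub_le_tsub_left (h t ht.1 ht.2) _

/-- The reverse comparison, for functions bounded by `ρ`. -/
theorem lintegral_le_of_le_meas_sublevel [IsFiniteMeasure μ] (hf : Measurable f)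
    (hfin : ∀ a, f a ≠ ∞) (hρ : 0 < ρ) (hfρ : ∀ᵐ a ∂μ, f a ≤ ENNReal.ofReal ρ)
    (h : ∀ s, 0 < s → s ≤ ρ →
      ENNReal.ofReal ((s / ρ) ^ d) * μ Set.univ ≤ μ {a | f a ≤ ENNReal.ofReal s}) :
    ∫⁻ a, f a ∂μ ≤ ENNReal.ofReal ((d : ℝ) / (d + 1) * ρ) * μ Set.univ := by
  rw [lintegral_eq_lintegral_meas_ofReal_lt hf hfin, ← lintegral_one_sub_pow d hρ,
    ← lintegral_mul_const _ (by fun_prop), ← Set.Ioc_union_Ioi_eq_Ioi hρ.le]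
  refine (lintegral_union_le _ _ _).trans ?_
  have hz : ∫⁻ t in Set.Ioi ρ, μ {a | ENNReal.ofReal t < f a} = 0 := by
    rw [setLIntegral_congr_fun (g := fun _ => 0) measurableSet_Ioi fun t ht => ?_, lintegral_zero]
    refine measure_mono_null (fun a ha => ?_) (ae_iff.1 hfρ)
    exact not_le.2 ((ENNReal.ofReal_le_ofReal (le_of_lt ht)).trans_lt ha)
  rw [hz, add_zero]
  refine setLIntegral_mono_ae' measurableSet_Ioc (Eventually.of_forall fun t ht => ?_)
  have hc : {a | ENNReal.ofReal t < f a} = {a | f a ≤ ENNReal.ofReal t}ᶜ := by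
    ext a; simp
  rw [hc, measure_compl (measurableSet_le hf measurable_const) (measure_ne_top _ _),
    ENNReal.ofReal_sub _ (pow_nonneg (div_nonneg ht.1.le hρ.le) d), ENNReal.ofReal_one,
    ENNReal.sub_mul (fun _ _ => measure_ne_top _ _), one_mul]
  exact tsub_le_tsub_left (h t ht.1 ht.2) _

end LayerCake

/-! ### Isoperimetric bounds for the cost -/

section Bathtub

variable {d : ℕ} {N : Seminorm ℝ (Fin d → ℝ)}

theorem distTo_ne_top {S : Finset (Fin d → ℝ)} (hS : S.Nonempty) (t : Fin d → ℝ) :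
    distTo N S t ≠ ∞ := by
  obtain ⟨x, hx⟩ := hS
  exact ((distTo_le_of_mem hx t).trans_lt ENNReal.ofReal_lt_top).ne

/-- Among all sets of the volume of `n` balls of radius `ρ`, none has a smaller cost than the
disjoint union of such balls. -/
theorem le_minCost {A : Set (Fin d → ℝ)} (hA : volume A ≠ ∞) {n : ℕ} {ρ : ℝ} (hρ : 0 < ρ)
    (hv : n * (ENNReal.ofReal (ρ ^ d) * volume (unitBall N)) = volume A) :
    ENNReal.ofReal ((d : ℝ) / (d + 1) * ρ) * volume A ≤ minCost N A n := by
  refine le_iInf₂ fun S hS => ?_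
  rcases S.eq_empty_or_nonempty with rfl | hne
  · rcases eq_or_ne (volume A) 0 with h0 | h0
    · simp [h0]
    · simp [nodeCost, distTo, ENNReal.top_mul h0]
  have : IsFiniteMeasure (volume.restrict A) := ⟨by simpa using hA.lt_top⟩
  have key := le_lintegral_of_meas_sublevel_le (μ := volume.restrict A) (d := d) (ρ := ρ)
    (measurable_distTo N S) (distTo_ne_top hne) hρ fun s hs _ => ?_
  · simpa [nodeCost] using key
  calc (volume.restrict A) {a | distTo N S a ≤ ENNReal.ofReal s}
      ≤ volume {a | distTo N S a ≤ ENNReal.ofReal s} := Measure.restrict_apply_le _ _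
    _ ≤ volume (⋃ x ∈ S, N.closedBall x s) := measure_mono fun t ht => by
        simpa using (distTo_le_ofReal_iff hs.le).1 ht
    _ ≤ ∑ x ∈ S, volume (N.closedBall x s) := measure_biUnion_finset_le _ _
    _ = S.card * (ENNReal.ofReal (s ^ d) * volume (unitBall N)) := by
        simp [N.volume_closedBall _ hs]
    _ ≤ n * (ENNReal.ofReal (s ^ d) * volume (unitBall N)) := by
        gcongr; exact hS.2
    _ = ENNReal.ofReal ((s / ρ) ^ d) * volume A := by
        rw [← hv, div_pow, mul_left_comm (ENNReal.ofReal (s ^ d / ρ ^ d)),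
          ← mul_assoc (ENNReal.ofReal _) (ENNReal.ofReal _), ← ENNReal.ofReal_mul (by positivity),
          div_mul_cancel₀ _ (by positivity)]
    _ = ENNReal.ofReal ((s / ρ) ^ d) * (volume.restrict A) Set.univ := by simp

/-- Shrinking a Voronoi cell towards its node stays inside the cell. -/
theorem seminorm_shrink_le {u w : Fin d → ℝ} {θ : ℝ} (hθ : θ ≤ 1) (hθ0 : 0 ≤ θ) :
    N (u - w) - N u ≤ N (θ • u - w) - N (θ • u) := by
  have h1 : N (u - w) ≤ N (θ • u - w) + N ((1 - θ) • u) := by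
    have : u - w = (θ • u - w) + (1 - θ) • u := by rw [sub_smul, one_smul]; abel
    rw [this]; exact map_add_le_add N _ _
  rw [map_smul_eq_mul, Real.norm_of_nonneg (by linarith)] at h1
  rw [map_smul_eq_mul N θ, Real.norm_of_nonneg hθ0]
  linarith

/-- If balls of radius `ρ` with centres in the convex set `A` cover `A`, then the balls of radius
`s ≤ ρ` cover at least the proportion `(s / ρ) ^ d` of `A`: the Voronoi cells are star-shaped. -/
theorem le_volume_distTo_le {A : Set (Fin d → ℝ)} (hA : Convex ℝ A) (hAm : MeasurableSet A)
    {S : Finset (Fin d → ℝ)} (hSA : ↑S ⊆ A) {ρ : ℝ} (hρ : 0 < ρ)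
    (hcov : ∀ t ∈ A, ∃ x ∈ S, t ∈ N.closedBall x ρ) {s : ℝ} (hs : 0 < s) (hsρ : s ≤ ρ) :
    ENNReal.ofReal ((s / ρ) ^ d) * volume A ≤
      volume (A ∩ {t | distTo N S t ≤ ENNReal.ofReal s}) := by
  classical
  set m := S.card
  let x : Fin m → (Fin d → ℝ) := fun i => S.equivFin.symm i
  have hxS : ∀ i, x i ∈ S := fun i => (S.equivFin.symm i).2
  have hxsurj : ∀ y ∈ S, ∃ i, x i = y := fun y hy => ⟨S.equivFin ⟨y, hy⟩, by simp [x]⟩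
  -- Voronoi cells, ties being decided in favour of the smallest index
  let V : Fin m → Set (Fin d → ℝ) := fun i =>
    {t | t ∈ A ∧ (∀ j, N (t - x i) ≤ N (t - x j)) ∧ ∀ j < i, N (t - x i) < N (t - x j)}
  have hcont : ∀ i, Continuous fun t => N (t - x i) := fun i =>
    N.continuous_pi.comp (continuous_id.sub continuous_const)
  have hVm : ∀ i, MeasurableSet (V i) := fun i => by
    have : V i = A ∩ ((⋂ j, {t | N (t - x i) ≤ N (t - x j)}) ∩
        ⋂ j, ⋂ (_ : j < i), {t | N (t - x i) < N (t - x j)}) := by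
      ext t; simp [V]; tauto
    rw [this]
    refine hAm.inter ((MeasurableSet.iInter fun j => ?_).inter
      (MeasurableSet.iInter fun j => MeasurableSet.iInter fun _ => ?_))
    · exact measurableSet_le (hcont i).measurable (hcont j).measurable
    · exact measurableSet_lt (hcont i).measurable (hcont j).measurable
  have hVdisj : Pairwise fun i j => Disjoint (V i) (V j) := by
    intro i j hij
    rw [Set.disjoint_left]
    intro t hi hj
    rcases lt_or_gt_of_ne hij with h | h
    · exact absurd (hi.2.1 j) (not_le.2 (hj.2.2 i h))
    · exact absurd (hj.2.1 i) (not_le.2 (hi.2.2 j h))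
  have hVcov : A ⊆ ⋃ i, V i := by
    intro t ht
    obtain ⟨y, hy, -⟩ := hcov t ht
    obtain ⟨i₀, -⟩ := hxsurj y hy
    have hne : (Finset.univ.filter fun i => ∀ j, N (t - x i) ≤ N (t - x j)).Nonempty := by
      obtain ⟨i, -, hi⟩ := Finset.exists_min_image Finset.univ (fun i => N (t - x i)) ⟨i₀, by simp⟩
      exact ⟨i, by simpa using hi⟩
    have hmem := Finset.min'_mem _ hne
    rw [Finset.mem_filter] at hmem
    refine Set.mem_iUnion.2 ⟨_, ht, hmem.2, fun j hj => lt_of_not_ge fun hle => ?_⟩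
    refine absurd (Finset.min'_le (Finset.univ.filter fun i => ∀ j, N (t - x i) ≤ N (t - x j)) j ?_)
      (not_le.2 hj)
    simpa using fun k => hle.trans (hmem.2 k)
  set θ := s / ρ with hθ
  have hθ0 : 0 < θ := div_pos hs hρ
  have hθ1 : θ ≤ 1 := (div_le_one hρ).2 hsρ
  have himage : ∀ i, AffineMap.homothety (x i) θ '' V i ⊆
      V i ∩ {t | distTo N S t ≤ ENNReal.ofReal s} := by
    rintro i _ ⟨t, ht, rfl⟩
    have hsub : AffineMap.homothety (x i) θ t - x i = θ • (t - x i) := by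
      simp [AffineMap.homothety_apply]
    have hsub' : ∀ j, AffineMap.homothety (x i) θ t - x j = θ • (t - x i) - (x j - x i) := by
      intro j; rw [← hsub]; abel
    have hsh : ∀ j, N (t - x j) - N (t - x i) ≤
        N (AffineMap.homothety (x i) θ t - x j) - N (AffineMap.homothety (x i) θ t - x i) := by
      intro j
      have := seminorm_shrink_le (N := N) (u := t - x i) (w := x j - x i) hθ1 hθ0.le
      rwa [hsub, hsub', show t - x j = t - x i - (x j - x i) by abel]
    refine ⟨⟨?_, fun j => ?_, fun j hj => ?_⟩, ?_⟩
    · rw [AffineMap.homothety_apply, vsub_eq_sub, vadd_eq_add, add_comm]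
      exact hA.add_smul_sub_mem (hSA (hxS i)) ht.1 ⟨hθ0.le, hθ1⟩
    · have := ht.2.1 j; have := hsh j; linarith
    · have := ht.2.2 j hj; have := hsh j; linarith
    · obtain ⟨y, hy, hyt⟩ := hcov t ht.1
      obtain ⟨j, rfl⟩ := hxsurj y hy
      refine (distTo_le_ofReal_iff hs.le).2 ⟨x i, hxS i, ?_⟩
      rw [Seminorm.mem_closedBall, hsub, map_smul_eq_mul, Real.norm_of_nonneg hθ0.le]
      calc θ * N (t - x i) ≤ θ * ρ := by
            gcongr; exact (ht.2.1 j).trans hyt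
        _ = s := by rw [hθ, div_mul_cancel₀ _ hρ.ne']
  have hBm : MeasurableSet {t | distTo N S t ≤ ENNReal.ofReal s} :=
    measurableSet_le (measurable_distTo N S) measurable_const
  calc ENNReal.ofReal (θ ^ d) * volume A
      ≤ ENNReal.ofReal (θ ^ d) * ∑ i, volume (V i) := by
        gcongr
        exact (measure_mono hVcov).trans (measure_iUnion_fintype_le _ _)
    _ = ∑ i, volume (AffineMap.homothety (x i) θ '' V i) := by
        rw [Finset.mul_sum]
        refine Finset.sum_congr rfl fun i _ => ?_
        rw [Measure.addHaar_image_homothety, abs_of_pos (by positivity)]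
        simp
    _ ≤ ∑ i, volume (V i ∩ {t | distTo N S t ≤ ENNReal.ofReal s}) :=
        Finset.sum_le_sum fun i _ => measure_mono (himage i)
    _ = volume (⋃ i, V i ∩ {t | distTo N S t ≤ ENNReal.ofReal s}) := by
        rw [measure_iUnion (fun i j hij => (hVdisj hij).mono Set.inter_subset_left
          Set.inter_subset_left) fun i => (hVm i).inter hBm, tsum_fintype]
    _ ≤ volume (A ∩ {t | distTo N S t ≤ ENNReal.ofReal s}) :=
        measure_mono (Set.iUnion_subset fun i => Set.inter_subset_inter_left _ fun t ht => ht.1)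

/-- The cost of nodes in a convex set `A` whose `ρ`-balls cover `A` is at most the cost of as many
disjoint `ρ`-balls, rescaled to the volume of `A`. -/
theorem nodeCost_le_of_cover {A : Set (Fin d → ℝ)} (hA : Convex ℝ A) (hAm : MeasurableSet A)
    (hfin : volume A ≠ ∞) {S : Finset (Fin d → ℝ)} (hSA : ↑S ⊆ A) (hne : S.Nonempty) {ρ : ℝ}
    (hρ : 0 < ρ) (hcov : ∀ t ∈ A, ∃ x ∈ S, t ∈ N.closedBall x ρ) :
    nodeCost N A S ≤ ENNReal.ofReal ((d : ℝ) / (d + 1) * ρ) * volume A := by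
  have : IsFiniteMeasure (volume.restrict A) := ⟨by simpa using hfin.lt_top⟩
  have key := lintegral_le_of_le_meas_sublevel (μ := volume.restrict A) (d := d) (ρ := ρ)
    (measurable_distTo N S) (distTo_ne_top hne) hρ ?_ fun s hs hsρ => ?_
  · simpa [nodeCost] using key
  · filter_upwards [ae_restrict_mem hAm] with t ht
    exact (distTo_le_ofReal_iff hρ.le).2 (hcov t ht)
  · rw [Measure.restrict_apply (measurableSet_le (measurable_distTo N S) measurable_const),
      Measure.restrict_apply MeasurableSet.univ, Set.univ_inter, Set.inter_comm]
    exact le_volume_distTo_le hA hAm hSA hρ hcov hs hsρ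

end Bathtub

/-! ### The radius of information as an integral of distances -/

section Radius

variable {d : ℕ} {N : Seminorm ℝ (Fin d → ℝ)}

theorem IsJordanDomain.nonempty {D : Set (Fin d → ℝ)} (hD : IsJordanDomain D) : D.Nonempty :=
  hD.2.mono interior_subset

theorem IsJordanDomain.volume_pos {D : Set (Fin d → ℝ)} (hD : IsJordanDomain D) : 0 < volume D :=
  (isOpen_interior.measure_pos volume hD.2).trans_le (measure_mono interior_subset)

theorem IsJordanMeasurable.volume_lt_top {D : Set (Fin d → ℝ)} (hD : IsJordanMeasurable D) :
    volume D < ∞ := hD.1.measure_lt_top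

theorem radiusInt_eq_nodeCost [DecidableEq (Fin d → ℝ)] {D : Set (Fin d → ℝ)}
    (hD : IsJordanMeasurable D) {n : ℕ} (hn : 1 ≤ n) (x : Fin n → D) :
    radiusInt N D x = nodeCost N D (Finset.univ.image fun i => (x i : Fin d → ℝ)) := by
  have hnull := hD.nullMeasurableSet
  have hne : (Finset.univ : Finset (Fin n)).Nonempty := ⟨⟨0, hn⟩, Finset.mem_univ _⟩
  let f : (Fin d → ℝ) → ℝ := fun t => Finset.univ.inf' hne fun i => N (t - x i)
  have hf0 : ∀ t, 0 ≤ f t := fun t => Finset.le_inf' _ _ fun i _ => apply_nonneg N _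
  have hfeq : ∀ t, ENNReal.ofReal (f t) =
      distTo N (Finset.univ.image fun i => (x i : Fin d → ℝ)) t := fun t => by
    have hmono : Monotone ENNReal.ofReal := ENNReal.ofReal_mono
    rw [distTo, Finset.inf_image, ← Finset.inf'_eq_inf hne]
    exact Finset.apply_inf'_eq_inf'_comp hne (g := ENNReal.ofReal)
      (fun a b => hmono.map_inf a b)
  have hcont : Continuous f := Continuous.finset_inf'_apply hne fun i _ =>
    N.continuous_pi.comp (continuous_id.sub continuous_const)
  apply le_antisymm
  · refine iSup₂_le fun g hg => ?_
    calc ENNReal.ofReal (∫ t in D, g t) ≤ ‖∫ t in D, g t‖ₑ := Real.ofReal_le_enorm _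
      _ ≤ ∫⁻ t in D, ‖g t‖ₑ := enorm_integral_le_lintegral_enorm _
      _ ≤ nodeCost N D _ := by
        refine lintegral_mono_ae ?_
        filter_upwards [ae_restrict_mem₀ hnull] with t ht
        refine Finset.le_inf fun y hy => ?_
        obtain ⟨i, -, rfl⟩ := Finset.mem_image.1 hy
        rw [← ofReal_norm, Real.norm_eq_abs]
        refine ENNReal.ofReal_le_ofReal ?_
        simpa [hg.2 i] using hg.1 t ht (x i) (x i).2
  · have hfmem : f ∈ {f | f ∈ lipClass N D ∧ ∀ i, f (x i : Fin d → ℝ) = 0} := by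
      refine ⟨fun s _ t _ => ?_, fun i => ?_⟩
      · have h1 : ∀ s t, f s ≤ f t + N (s - t) := fun s t => by
          obtain ⟨i, -, hi⟩ := Finset.exists_mem_eq_inf' hne fun i => N (t - x i)
          have h2 : f s ≤ N (s - x i) := Finset.inf'_le _ (Finset.mem_univ i)
          have h3 : N (s - x i) ≤ N (s - t) + N (t - x i) := by
            rw [show s - (x i : Fin d → ℝ) = s - t + (t - x i) by abel]
            exact map_add_le_add N _ _
          have h4 : f t = N (t - x i) := hi
          linarith
        rw [abs_le]
        have h2 := h1 t s
        rw [map_sub_rev N] at h2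
        constructor <;> linarith [h1 s t]
      · refine le_antisymm ?_ (hf0 _)
        have : f (x i) ≤ N ((x i : Fin d → ℝ) - x i) := Finset.inf'_le _ (Finset.mem_univ i)
        simpa using this
    refine le_trans ?_ (le_iSup₂ (f := fun g _ => ENNReal.ofReal (∫ t in D, g t)) f hfmem)
    have hint : Integrable f (volume.restrict D) :=
      (hcont.continuousOn.integrableOn_compact hD.1.isCompact_closure).mono_set subset_closure
    rw [ofReal_integral_eq_lintegral_ofReal hint (Eventually.of_forall hf0), nodeCost]
    exact (lintegral_congr hfeq).ge

theorem optErrInt_eq_minCost {D : Set (Fin d → ℝ)} (hD : IsJordanDomain D) {n : ℕ} (hn : 1 ≤ n) :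
    optErrInt N D n = minCost N D n := by
  classical
  apply le_antisymm
  · refine le_iInf₂ fun S hS => ?_
    rcases S.eq_empty_or_nonempty with rfl | ⟨y, hy⟩
    · simp [nodeCost, distTo, ENNReal.top_mul hD.volume_pos.ne']
    have : NeZero n := ⟨by omega⟩
    -- an enumeration of `S` by `Fin n`, with repetitions
    let x : Fin n → D := fun i =>
      if h : (i : ℕ) < S.card then ⟨S.equivFin.symm ⟨i, h⟩, hS.1 (S.equivFin.symm ⟨i, h⟩).2⟩
      else ⟨y, hS.1 hy⟩
    refine (iInf_le _ x).trans ?_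
    rw [radiusInt_eq_nodeCost hD.1 hn]
    refine lintegral_mono fun t => distTo_anti (fun z hz => ?_) t
    have hlt : ((S.equivFin ⟨z, hz⟩ : Fin S.card) : ℕ) < S.card := (S.equivFin ⟨z, hz⟩).2
    refine Finset.mem_image.2 ⟨⟨S.equivFin ⟨z, hz⟩, hlt.trans_le hS.2⟩, Finset.mem_univ _, ?_⟩
    simp [x]
  · refine le_iInf fun x => ?_
    rw [radiusInt_eq_nodeCost hD.1 hn]
    refine minCost_le ?_ (Finset.card_image_le.trans (by simp))
    intro z hz
    obtain ⟨i, -, rfl⟩ := Finset.mem_image.1 (Finset.mem_coe.1 hz)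
    exact (x i).2

end Radius

/-! ### Coverings from maximal packings -/

section Packing

variable {d : ℕ} {N : Seminorm ℝ (Fin d → ℝ)}

/-- The centres of a maximal packing of `η`-balls centred in `A` form a set of centres of
`2η`-balls that cover `A`; their number is bounded by volume. -/
theorem exists_cover_card_mul_le {A W : Set (Fin d → ℝ)} {η : ℝ} (hη : 0 < η)
    (hW : ∀ x ∈ A, N.closedBall x η ⊆ W) (hWfin : volume W ≠ ∞) :
    ∃ S : Finset (Fin d → ℝ), ↑S ⊆ A ∧ (∀ t ∈ A, ∃ x ∈ S, t ∈ N.closedBall x (2 * η)) ∧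
      S.card * (ENNReal.ofReal (η ^ d) * volume (unitBall N)) ≤ volume W := by
  classical
  set w := ENNReal.ofReal (η ^ d) * volume (unitBall N) with hw
  have hw0 : w ≠ 0 := mul_ne_zero (by positivity) (volume_unitBall_pos N).ne'
  let P : Finset (Fin d → ℝ) → Prop := fun S => ↑S ⊆ A ∧
    ∀ x ∈ S, ∀ y ∈ S, x ≠ y → 2 * η < N (x - y)
  have hcard : ∀ S, P S → S.card * w ≤ volume W := by
    intro S hS
    calc S.card * w = ∑ x ∈ S, volume (N.closedBall x η) := by
          simp [N.volume_closedBall _ hη, hw]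
      _ = volume (⋃ x ∈ S, N.closedBall x η) := by
          refine (measure_biUnion_finset (fun x hx y hy hxy => ?_)
            fun x _ => (N.isClosed_closedBall_pi x η).measurableSet).symm
          rw [Function.onFun, Set.disjoint_left]
          intro t htx hty
          have h1 := hS.2 x hx y hy hxy
          have h2 : N (x - y) ≤ N (t - x) + N (t - y) := by
            rw [show x - y = (x - t) + (t - y) by abel, ← map_sub_rev N x t]
            exact map_add_le_add N _ _
          rw [Seminorm.mem_closedBall] at htx hty
          linarith
      _ ≤ volume W := measure_mono (Set.iUnion₂_subset fun x hx => hW x (hS.1 hx))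
  have hbdd : ∃ m : ℕ, ∀ S, P S → S.card ≤ m := by
    obtain ⟨m, hm⟩ := ENNReal.exists_nat_mul_gt hw0 hWfin
    refine ⟨m, fun S hS => ?_⟩
    by_contra hlt
    have h1 : (m : ℝ≥0∞) * w ≤ S.card * w := by
      gcongr; omega
    exact absurd (hm.trans_le (h1.trans (hcard S hS))) (lt_irrefl _)
  obtain ⟨m, hm⟩ := hbdd
  have hex : ∃ k, ∃ S, P S ∧ S.card = k := ⟨0, ∅, ⟨by simp, by simp⟩, rfl⟩
  have hspec := Nat.findGreatest_spec (P := fun k => ∃ S, P S ∧ S.card = k) (Nat.zero_le m)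
    ⟨∅, ⟨by simp, by simp⟩, rfl⟩
  obtain ⟨S, hS, hSk⟩ := hspec
  refine ⟨S, hS.1, fun t ht => ?_, hcard S hS⟩
  by_contra hno
  push Not at hno
  have hno' : ∀ x ∈ S, 2 * η < N (t - x) := fun x hx => by
    simpa [Seminorm.mem_closedBall] using hno x hx
  have htS : t ∉ S := fun h => by
    have := hno' t h; simp at this; linarith
  have hP : P (insert t S) := by
    refine ⟨?_, ?_⟩
    · rw [Finset.coe_insert]; exact Set.insert_subset ht hS.1
    · intro x hx y hy hxy
      rcases Finset.mem_insert.1 hx with hxt | hxS <;> rcases Finset.mem_insert.1 hy with hyt | hyS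
      · exact absurd (hxt.trans hyt.symm) hxy
      · rw [hxt]; exact hno' y hyS
      · rw [hyt, map_sub_rev N]; exact hno' x hxS
      · exact hS.2 x hxS y hyS hxy
  have hc : (insert t S).card = S.card + 1 := Finset.card_insert_of_notMem htS
  have := Nat.le_findGreatest (P := fun k => ∃ S, P S ∧ S.card = k) (hm _ hP) ⟨_, hP, rfl⟩
  omega

/-- Subsets of a fixed bounded set have `n` nodes of cost `O(n^{-1/d})` times their volume. -/
theorem exists_minCost_le_volume_mul (hd : 1 ≤ d) (hN : ∀ x, N x = 0 → x = 0)
    {W : Set (Fin d → ℝ)} (hW : Bornology.IsBounded W) :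
    ∃ C : ℝ, 0 < C ∧ ∀ᶠ n : ℕ in atTop, ∀ A ⊆ W,
      minCost N A n ≤ ENNReal.ofReal (C * (n : ℝ) ^ (-(1 / (d : ℝ)))) * volume A := by
  obtain ⟨c, hc, hcN⟩ := Seminorm.exists_norm_le_mul hN
  set v := (volume (unitBall N)).toReal with hv
  have hv0 : 0 < v := ENNReal.toReal_pos (volume_unitBall_pos N).ne' (volume_unitBall_lt_top hN).ne
  have hvE : volume (unitBall N) = ENNReal.ofReal v :=
    (ENNReal.ofReal_toReal (volume_unitBall_lt_top hN).ne).symm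
  have hb : Bornology.IsBounded (Metric.cthickening c W) := hW.cthickening
  set V := (volume (Metric.cthickening c W)).toReal + 1 with hV
  have hV0 : 0 < V := by positivity
  have hVE : volume (Metric.cthickening c W) ≤ ENNReal.ofReal V := by
    rw [← ENNReal.ofReal_toReal hb.measure_lt_top.ne]
    exact ENNReal.ofReal_le_ofReal (by linarith)
  have hdR : (0 : ℝ) < d := by exact_mod_cast hd
  set K := (V / v) ^ (1 / (d : ℝ)) with hK
  have hK0 : 0 < K := by positivity
  refine ⟨2 * K, by positivity, ?_⟩
  have hlim : Tendsto (fun n : ℕ => K * (n : ℝ) ^ (-(1 / (d : ℝ)))) atTop (𝓝 (K * 0)) :=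
    ((tendsto_rpow_neg_atTop (by positivity)).comp tendsto_natCast_atTop_atTop).const_mul K
  rw [mul_zero] at hlim
  filter_upwards [hlim.eventually (gt_mem_nhds one_pos), eventually_ge_atTop 1] with n hn1 hn A hA
  set η := K * (n : ℝ) ^ (-(1 / (d : ℝ))) with hη
  have hn0 : (0 : ℝ) < n := by exact_mod_cast hn
  have hη0 : 0 < η := by positivity
  have hηd : η ^ d * v = V / n := by
    rw [hη, mul_pow, hK, ← Real.rpow_natCast, ← Real.rpow_mul (by positivity),
      one_div_mul_cancel hdR.ne', Real.rpow_one, ← Real.rpow_natCast, ← Real.rpow_mul hn0.le,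
      neg_mul, one_div_mul_cancel hdR.ne', Real.rpow_neg_one]
    field_simp
  have hWη : ∀ x ∈ A, N.closedBall x η ⊆ Metric.cthickening c W := fun x hx y hy => by
    refine Metric.mem_cthickening_of_dist_le y x c W (hA hx) ?_
    rw [dist_eq_norm]
    refine (hcN _).trans ?_
    rw [Seminorm.mem_closedBall] at hy
    nlinarith
  obtain ⟨S, hSA, hcov, hcard⟩ := exists_cover_card_mul_le hη0 hWη hb.measure_lt_top.ne
  have hSn : S.card ≤ n := by
    have h1 := hcard.trans hVE
    rw [hvE, ← ENNReal.ofReal_mul (pow_nonneg hη0.le d), hηd, ← ENNReal.ofReal_natCast,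
      ← ENNReal.ofReal_mul (Nat.cast_nonneg _), ENNReal.ofReal_le_ofReal_iff hV0.le,
      ← mul_div_assoc, div_le_iff₀ hn0, mul_comm] at h1
    exact_mod_cast le_of_mul_le_mul_left h1 hV0
  refine (minCost_le hSA hSn).trans ?_
  calc nodeCost N A S ≤ ∫⁻ t in A, ENNReal.ofReal (2 * η) := by
        refine setLIntegral_mono measurable_const fun t ht => ?_
        exact (distTo_le_ofReal_iff (by positivity)).2 (hcov t ht)
    _ = _ := by rw [setLIntegral_const, hη]; congr 2; ring

end Packing

/-! ### The constant of the unit cube -/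

section Cube

variable {d : ℕ} {N : Seminorm ℝ (Fin d → ℝ)}

noncomputable section

/-- The constant `κ = inf_n n^{1/d} e_n([0,1]^d)`, the infimum being over `n ≥ 1`. By
self-similarity of the cube it is also the limit. -/
def cubeConst (N : Seminorm ℝ (Fin d → ℝ)) : ℝ :=
  ⨅ n : ℕ, ((n + 1 : ℕ) : ℝ) ^ (1 / (d : ℝ)) *
    (minCost N (Set.Icc (0 : Fin d → ℝ) 1) (n + 1)).toReal

end

theorem cubeConst_nonneg (N : Seminorm ℝ (Fin d → ℝ)) : 0 ≤ cubeConst N :=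
  Real.iInf_nonneg fun _ => mul_nonneg (by positivity) ENNReal.toReal_nonneg

theorem minCost_unitCube_ne_top (N : Seminorm ℝ (Fin d → ℝ)) {n : ℕ} (hn : 1 ≤ n) :
    minCost N (Set.Icc (0 : Fin d → ℝ) 1) n ≠ ∞ := by
  obtain ⟨C, hC, h⟩ := N.exists_le_mul_norm
  refine ((minCost_le (S := {0}) (by simp) (by simpa using hn)).trans
    (nodeCost_le_of_cover (convex_Icc 0 1) measurableSet_Icc (by simp [Real.volume_Icc_pi])
      (by simp) (Finset.singleton_nonempty _) hC fun t ht => ⟨0, by simp, ?_⟩)).trans_lt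
    (ENNReal.mul_lt_top ENNReal.ofReal_lt_top (by simp [Real.volume_Icc_pi])) |>.ne
  rw [Seminorm.mem_closedBall, sub_zero]
  refine (h t).trans (mul_le_of_le_one_right hC.le ?_)
  refine (pi_norm_le_iff_of_nonneg zero_le_one).2 fun i => ?_
  rw [Real.norm_eq_abs, abs_le]
  have h0 := ht.1 i
  have h1 := ht.2 i
  simp only [Pi.zero_apply, Pi.one_apply] at h0 h1
  constructor <;> linarith

theorem cubeConst_le_mul {n : ℕ} (hn : 1 ≤ n) :
    cubeConst N ≤ (n : ℝ) ^ (1 / (d : ℝ)) *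
      (minCost N (Set.Icc (0 : Fin d → ℝ) 1) n).toReal := by
  obtain ⟨m, rfl⟩ : ∃ m, n = m + 1 := ⟨n - 1, by omega⟩
  exact ciInf_le ⟨0, by rintro _ ⟨n, rfl⟩; positivity⟩ m

theorem le_minCost_unitCube {n : ℕ} (hn : 1 ≤ n) :
    ENNReal.ofReal (cubeConst N * (n : ℝ) ^ (-(1 / (d : ℝ)))) ≤
      minCost N (Set.Icc (0 : Fin d → ℝ) 1) n := by
  refine ENNReal.ofReal_le_of_le_toReal ?_
  have hn0 : (0 : ℝ) < n := by exact_mod_cast hn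
  rw [Real.rpow_neg hn0.le, ← div_eq_mul_inv, div_le_iff₀ (by positivity), mul_comm]
  exact cubeConst_le_mul hn

theorem image_affine_unitCube (a : Fin d → ℝ) {s : ℝ} (hs : 0 < s) :
    (fun x => a + s • x) '' Set.Icc (0 : Fin d → ℝ) 1 = Set.Icc a (fun i => a i + s) := by
  ext y
  simp only [Set.mem_image, Set.mem_Icc, Pi.le_def, Pi.zero_apply, Pi.one_apply]
  constructor
  · rintro ⟨x, hx, rfl⟩
    exact ⟨fun i => by simpa using mul_nonneg hs.le (hx.1 i),
      fun i => by simpa using mul_le_of_le_one_right hs.le (hx.2 i)⟩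
  · rintro ⟨h0, h1⟩
    refine ⟨s⁻¹ • (y - a), ⟨fun i => ?_, fun i => ?_⟩, ?_⟩
    · simpa using mul_nonneg (inv_pos.2 hs).le (sub_nonneg.2 (h0 i))
    · simp only [Pi.smul_apply, Pi.sub_apply, smul_eq_mul]
      rw [inv_mul_le_iff₀ hs]
      linarith [h1 i]
    · simp [smul_inv_smul₀ hs.ne']

theorem minCost_cube_le (a : Fin d → ℝ) {s : ℝ} (hs : 0 < s) (n : ℕ) :
    minCost N (Set.Icc a fun i => a i + s) n ≤
      ENNReal.ofReal (s ^ (d + 1)) * minCost N (Set.Icc (0 : Fin d → ℝ) 1) n := by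
  rw [← image_affine_unitCube a hs]
  exact minCost_affine_le measurableSet_Icc a hs n

/-- The lower bound for cubes holds for every number of nodes, not only asymptotically. -/
theorem le_minCost_cube (a : Fin d → ℝ) {s : ℝ} (hs : 0 < s) {n : ℕ} (hn : 1 ≤ n) :
    ENNReal.ofReal (cubeConst N * s ^ (d + 1) * (n : ℝ) ^ (-(1 / (d : ℝ)))) ≤
      minCost N (Set.Icc a fun i => a i + s) n := by
  have h := minCost_affine_le (N := N) (measurableSet_Icc (a := a) (b := fun i => a i + s))
    (-(s⁻¹ • a)) (inv_pos.2 hs) n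
  have himg : (fun x => -(s⁻¹ • a) + s⁻¹ • x) '' Set.Icc a (fun i => a i + s) =
      Set.Icc (0 : Fin d → ℝ) 1 := by
    rw [← image_affine_unitCube a hs, Set.image_image]
    simp [smul_smul, inv_mul_cancel₀ hs.ne']
  rw [himg] at h
  calc ENNReal.ofReal (cubeConst N * s ^ (d + 1) * (n : ℝ) ^ (-(1 / (d : ℝ))))
      = ENNReal.ofReal (s ^ (d + 1)) *
          ENNReal.ofReal (cubeConst N * (n : ℝ) ^ (-(1 / (d : ℝ)))) := by
        rw [← ENNReal.ofReal_mul (by positivity)]; congr 1; ring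
    _ ≤ ENNReal.ofReal (s ^ (d + 1)) * (ENNReal.ofReal (s⁻¹ ^ (d + 1)) *
          minCost N (Set.Icc a fun i => a i + s) n) := by
        gcongr
        exact (le_minCost_unitCube hn).trans h
    _ = minCost N (Set.Icc a fun i => a i + s) n := by
        rw [← mul_assoc, ← ENNReal.ofReal_mul (by positivity), ← mul_pow, mul_inv_cancel₀ hs.ne']
        simp

theorem unitCube_eq_iUnion {k : ℕ} (hk : 1 ≤ k) :
    Set.Icc (0 : Fin d → ℝ) 1 = ⋃ j ∈ (Finset.univ : Finset (Fin d → Fin k)),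
      Set.Icc (fun i => ((j i : ℕ) : ℝ) * (k : ℝ)⁻¹)
        (fun i => ((j i : ℕ) : ℝ) * (k : ℝ)⁻¹ + (k : ℝ)⁻¹) := by
  have hk0 : (0 : ℝ) < k := by exact_mod_cast hk
  have hk1 : (k : ℝ) * (k : ℝ)⁻¹ = 1 := mul_inv_cancel₀ hk0.ne'
  have hk2 : (0 : ℝ) < (k : ℝ)⁻¹ := inv_pos.2 hk0
  ext x
  simp only [Finset.mem_univ, Set.iUnion_true, Set.mem_iUnion, Set.mem_Icc, Pi.le_def,
    Pi.zero_apply, Pi.one_apply]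
  constructor
  · rintro ⟨h0, h1⟩
    refine ⟨fun i => ⟨min ⌊k * x i⌋₊ (k - 1), by omega⟩, fun i => ?_, fun i => ?_⟩
    · have : ((min ⌊k * x i⌋₊ (k - 1) : ℕ) : ℝ) ≤ k * x i :=
        (Nat.cast_le.2 (min_le_left _ _)).trans (Nat.floor_le (mul_nonneg hk0.le (h0 i)))
      rw [← div_eq_mul_inv, div_le_iff₀ hk0, mul_comm]
      exact this
    · rw [← add_one_mul, ← div_eq_mul_inv, le_div_iff₀ hk0, mul_comm]
      simp only
      rcases min_choice ⌊k * x i⌋₊ (k - 1) with h | h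
      · rw [h]; exact (Nat.lt_floor_add_one _).le
      · rw [h, Nat.cast_sub hk, Nat.cast_one, sub_add_cancel]
        exact mul_le_of_le_one_right hk0.le (h1 i)
  · rintro ⟨j, h0, h1⟩
    refine ⟨fun i => (by positivity : (0 : ℝ) ≤ (j i : ℕ) * (k : ℝ)⁻¹).trans (h0 i), fun i =>
      (h1 i).trans ?_⟩
    have : ((j i : ℕ) : ℝ) + 1 ≤ k := by exact_mod_cast (j i).2
    calc ((j i : ℕ) : ℝ) * (k : ℝ)⁻¹ + (k : ℝ)⁻¹ = (((j i : ℕ) : ℝ) + 1) * (k : ℝ)⁻¹ := by ring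
      _ ≤ k * (k : ℝ)⁻¹ := by gcongr
      _ = 1 := hk1

/-- Self-similarity of the cube: `k ^ d` scaled copies of a set of nodes. -/
theorem minCost_unitCube_pow_mul_le {k : ℕ} (hk : 1 ≤ k) (n : ℕ) :
    minCost N (Set.Icc (0 : Fin d → ℝ) 1) (k ^ d * n) ≤
      ENNReal.ofReal (k : ℝ)⁻¹ * minCost N (Set.Icc (0 : Fin d → ℝ) 1) n := by
  have hk0 : (0 : ℝ) < k := by exact_mod_cast hk
  have hcard : k ^ d = (Finset.univ : Finset (Fin d → Fin k)).card := by simp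
  conv_lhs => rw [unitCube_eq_iUnion hk, hcard]
  refine (minCost_biUnion_le _ _ _).trans ((Finset.sum_le_sum fun j _ =>
    minCost_cube_le _ (inv_pos.2 hk0) n).trans ?_)
  rw [Finset.sum_const, ← hcard, nsmul_eq_mul, ← mul_assoc]
  refine le_of_eq ?_
  congr 1
  rw [← ENNReal.ofReal_natCast, ← ENNReal.ofReal_mul (by positivity)]
  congr 1
  rw [Nat.cast_pow, pow_succ, ← mul_assoc, ← mul_pow, mul_inv_cancel₀ hk0.ne', one_pow, one_mul]

theorem eventually_minCost_unitCube_le (hd : 1 ≤ d) {c : ℝ} (hc : cubeConst N < c) :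
    ∀ᶠ n : ℕ in atTop, minCost N (Set.Icc (0 : Fin d → ℝ) 1) n ≤
      ENNReal.ofReal (c * (n : ℝ) ^ (-(1 / (d : ℝ)))) := by
  have hdR : (0 : ℝ) < d := by exact_mod_cast hd
  obtain ⟨m, hm⟩ := exists_lt_of_ciInf_lt hc
  set M := m + 1 with hM
  set E := (minCost N (Set.Icc (0 : Fin d → ℝ) 1) M).toReal with hE
  have hEfin := minCost_unitCube_ne_top N (show 1 ≤ M by omega)
  have hM0 : (0 : ℝ) < M := by positivity
  set a : ℝ := (M : ℝ) ^ (-(1 / (d : ℝ))) with ha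
  have ha0 : 0 < a := by positivity
  have hx : Tendsto (fun n : ℕ => (n : ℝ) ^ (1 / (d : ℝ))) atTop atTop :=
    (tendsto_rpow_atTop (by positivity)).comp tendsto_natCast_atTop_atTop
  have hfl := (tendsto_nat_floor_mul_div_atTop ha0.le).comp hx
  have hlim : Tendsto (fun n : ℕ => E * ((⌊a * (n : ℝ) ^ (1 / (d : ℝ))⌋₊ : ℝ) /
      (n : ℝ) ^ (1 / (d : ℝ)))⁻¹) atTop (𝓝 (E * a⁻¹)) := (hfl.inv₀ ha0.ne').const_mul E
  have hlt : E * a⁻¹ < c := by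
    rw [ha, Real.rpow_neg hM0.le, inv_inv, mul_comm]; exact hm
  have hbig := (tendsto_nat_floor_atTop.comp (hx.const_mul_atTop ha0)).eventually_ge_atTop 1
  filter_upwards [hlim.eventually (gt_mem_nhds hlt), hbig, eventually_ge_atTop 1] with n hn hk hn1
  have hn0 : (0 : ℝ) < n := by exact_mod_cast hn1
  set k := ⌊a * (n : ℝ) ^ (1 / (d : ℝ))⌋₊ with hkdef
  have hk' : 1 ≤ k := hk
  have hk0 : (0 : ℝ) < k := by exact_mod_cast hk'
  have hkn : k ^ d * M ≤ n := by
    have h1 : (k : ℝ) ≤ a * (n : ℝ) ^ (1 / (d : ℝ)) := Nat.floor_le (by positivity)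
    have h2 : (k : ℝ) ^ d ≤ (a * (n : ℝ) ^ (1 / (d : ℝ))) ^ d := by gcongr
    have h3 : (a * (n : ℝ) ^ (1 / (d : ℝ))) ^ d = n / M := by
      rw [mul_pow, ha, ← Real.rpow_natCast, ← Real.rpow_mul hM0.le, ← Real.rpow_natCast,
        ← Real.rpow_mul hn0.le, neg_mul, one_div_mul_cancel hdR.ne', Real.rpow_neg_one,
        Real.rpow_one, inv_mul_eq_div]
    rw [h3, le_div_iff₀ hM0] at h2
    exact_mod_cast h2
  calc minCost N (Set.Icc (0 : Fin d → ℝ) 1) n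
      ≤ minCost N (Set.Icc (0 : Fin d → ℝ) 1) (k ^ d * M) := minCost_anti _ hkn
    _ ≤ ENNReal.ofReal (k : ℝ)⁻¹ * ENNReal.ofReal E := by
        rw [hE, ENNReal.ofReal_toReal hEfin]; exact minCost_unitCube_pow_mul_le hk' M
    _ = ENNReal.ofReal ((k : ℝ)⁻¹ * E) := (ENNReal.ofReal_mul (by positivity)).symm
    _ ≤ _ := by
        refine ENNReal.ofReal_le_ofReal ?_
        have hp : 0 < (n : ℝ) ^ (1 / (d : ℝ)) := by positivity
        rw [Real.rpow_neg hn0.le, ← div_eq_mul_inv, le_div_iff₀ hp]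
        rw [inv_div, ← mul_div_assoc] at hn
        rw [inv_mul_eq_div, div_mul_eq_mul_div]
        exact hn.le

end Cube

/-! ### Asymptotic upper bound for Jordan measurable sets -/

section Upper

variable {d : ℕ} {N : Seminorm ℝ (Fin d → ℝ)}

/-- Change of the number of nodes by an asymptotically constant factor `α`. -/
theorem tendsto_rpow_comp_div {p α : ℝ} (hα : 0 < α) {g : ℕ → ℕ}
    (hg : Tendsto (fun n : ℕ => (g n : ℝ) / n) atTop (𝓝 α)) :
    Tendsto (fun n : ℕ => (g n : ℝ) ^ p / (n : ℝ) ^ p) atTop (𝓝 (α ^ p)) := by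
  refine (hg.rpow_const (Or.inl hα.ne')).congr fun n => ?_
  exact Real.div_rpow (by positivity) (by positivity) _

theorem tendsto_atTop_of_tendsto_div {α : ℝ} (hα : 0 < α) {g : ℕ → ℕ}
    (hg : Tendsto (fun n : ℕ => (g n : ℝ) / n) atTop (𝓝 α)) : Tendsto g atTop atTop := by
  have h : Tendsto (fun n : ℕ => (g n : ℝ) / n * n) atTop atTop :=
    hg.pos_mul_atTop hα tendsto_natCast_atTop_atTop
  refine (tendsto_natCast_atTop_iff (R := ℝ)).1 (h.congr' ?_)
  filter_upwards [eventually_ge_atTop 1] with n hn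
  exact div_mul_cancel₀ _ (by positivity)

theorem eventually_comp_le {f : ℕ → ℝ≥0∞} {p c c' α : ℝ} (hα : 0 < α) {g : ℕ → ℕ}
    (hg : Tendsto (fun n : ℕ => (g n : ℝ) / n) atTop (𝓝 α))
    (hf : ∀ᶠ n : ℕ in atTop, f n ≤ ENNReal.ofReal (c * (n : ℝ) ^ p)) (hc : c * α ^ p < c') :
    ∀ᶠ n : ℕ in atTop, f (g n) ≤ ENNReal.ofReal (c' * (n : ℝ) ^ p) := by
  have hlim := (tendsto_rpow_comp_div (p := p) hα hg).const_mul c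
  filter_upwards [(tendsto_atTop_of_tendsto_div hα hg).eventually hf,
    hlim.eventually (gt_mem_nhds hc), eventually_ge_atTop 1] with n h1 h2 hn
  have hn0 : (0 : ℝ) < n := by exact_mod_cast hn
  refine h1.trans (ENNReal.ofReal_le_ofReal ?_)
  rw [← mul_div_assoc, div_lt_iff₀ (by positivity)] at h2
  exact h2.le

theorem tendsto_floor_mul_div {α : ℝ} (hα : 0 ≤ α) :
    Tendsto (fun n : ℕ => (⌊α * (n : ℝ)⌋₊ : ℝ) / n) atTop (𝓝 α) :=
  (tendsto_nat_floor_mul_div_atTop hα).comp tendsto_natCast_atTop_atTop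

/-- Equal cubes share the nodes equally. -/
theorem eventually_minCost_cubes_le (hd : 1 ≤ d) (J : Finset (Fin d → ℝ)) {s : ℝ} (hs : 0 < s)
    {c : ℝ} (hc : cubeConst N * (J.card * s ^ d) ^ (1 + 1 / (d : ℝ)) < c) :
    ∀ᶠ n : ℕ in atTop, minCost N (⋃ a ∈ J, Set.Icc a fun i => a i + s) n ≤
      ENNReal.ofReal (c * (n : ℝ) ^ (-(1 / (d : ℝ)))) := by
  have hdR : (0 : ℝ) < d := by exact_mod_cast hd
  rcases J.eq_empty_or_nonempty with rfl | hJ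
  · simp [minCost_empty]
  set m := J.card with hm
  have hm0 : (0 : ℝ) < m := by exact_mod_cast hJ.card_pos
  have hkey : cubeConst N * (m * s ^ (d + 1)) * ((m : ℝ)⁻¹) ^ (-(1 / (d : ℝ))) < c := by
    refine lt_of_eq_of_lt ?_ hc
    rw [Real.inv_rpow hm0.le, Real.rpow_neg hm0.le, inv_inv, Real.rpow_add (by positivity),
      Real.rpow_one, Real.mul_rpow hm0.le (by positivity), ← Real.rpow_natCast s d,
      ← Real.rpow_mul hs.le, mul_one_div_cancel hdR.ne', Real.rpow_one, Real.rpow_natCast]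
    ring
  obtain ⟨c₁, hc₁, hc₁'⟩ : ∃ c₁, cubeConst N < c₁ ∧
      c₁ * (m * s ^ (d + 1)) * ((m : ℝ)⁻¹) ^ (-(1 / (d : ℝ))) < c := by
    have hcont : Tendsto (fun c₁ : ℝ => c₁ * (m * s ^ (d + 1)) * ((m : ℝ)⁻¹) ^ (-(1 / (d : ℝ))))
        (𝓝[>] cubeConst N) (𝓝 (cubeConst N * (m * s ^ (d + 1)) *
          ((m : ℝ)⁻¹) ^ (-(1 / (d : ℝ))))) :=
      ((continuous_id.mul continuous_const).mul continuous_const).tendsto' _ _ rfl |>.mono_left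
        nhdsWithin_le_nhds
    obtain ⟨c₁, h1, h2⟩ := ((hcont.eventually (gt_mem_nhds hkey)).and
      self_mem_nhdsWithin).exists
    exact ⟨c₁, h2, h1⟩
  have hstep : ∀ᶠ n : ℕ in atTop, (m : ℝ≥0∞) * (ENNReal.ofReal (s ^ (d + 1)) *
      minCost N (Set.Icc (0 : Fin d → ℝ) 1) n) ≤
      ENNReal.ofReal (c₁ * (m * s ^ (d + 1)) * (n : ℝ) ^ (-(1 / (d : ℝ)))) := by
    filter_upwards [eventually_minCost_unitCube_le hd hc₁] with n hn
    calc (m : ℝ≥0∞) * (ENNReal.ofReal (s ^ (d + 1)) * minCost N (Set.Icc (0 : Fin d → ℝ) 1) n)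
        ≤ (m : ℝ≥0∞) * (ENNReal.ofReal (s ^ (d + 1)) *
            ENNReal.ofReal (c₁ * (n : ℝ) ^ (-(1 / (d : ℝ))))) := by gcongr
      _ = _ := by
        rw [← ENNReal.ofReal_natCast, ← ENNReal.ofReal_mul (by positivity),
          ← ENNReal.ofReal_mul (by positivity)]
        congr 1; ring
  filter_upwards [eventually_comp_le (inv_pos.2 hm0) (tendsto_floor_mul_div (inv_pos.2 hm0).le)
    hstep hc₁'] with n hn
  have hle : m * ⌊(m : ℝ)⁻¹ * (n : ℝ)⌋₊ ≤ n := by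
    have := Nat.floor_le (show 0 ≤ (m : ℝ)⁻¹ * (n : ℝ) by positivity)
    rw [inv_mul_eq_div, le_div_iff₀ hm0, mul_comm, ← inv_mul_eq_div] at this
    exact_mod_cast this
  refine (minCost_anti _ hle).trans (((minCost_biUnion_le J _ _).trans ?_).trans hn)
  refine (Finset.sum_le_sum fun a _ => minCost_cube_le a hs _).trans ?_
  rw [Finset.sum_const, nsmul_eq_mul]

/-- A compact subset of an open set is covered by finitely many cubes of equal size inside the open
set, without overlaps of positive measure. -/
theorem exists_cubes_between {K U : Set (Fin d → ℝ)} (hK : IsCompact K) (hU : IsOpen U)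
    (hKU : K ⊆ U) : ∃ s : ℝ, 0 < s ∧ ∃ J : Finset (Fin d → ℝ),
      (⋃ a ∈ J, Set.Icc a fun i => a i + s) ⊆ U ∧ (K ⊆ ⋃ a ∈ J, Set.Icc a fun i => a i + s) ∧
      J.card * ENNReal.ofReal (s ^ d) ≤ volume U := by
  classical
  obtain ⟨δ, hδ, hδU⟩ := hK.exists_thickening_subset_open hU hKU
  set s := δ / 2 with hs
  have hs0 : 0 < s := by positivity
  let F : (Fin d → ℝ) → (Fin d → ℝ) := fun t i => s * (⌊t i / s⌋ : ℝ)
  have hFmem : ∀ t, t ∈ Set.Icc (F t) fun i => F t i + s := fun t => by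
    refine ⟨fun i => ?_, fun i => ?_⟩
    · have := Int.floor_le (t i / s)
      rw [le_div_iff₀ hs0] at this
      simp only [F]; linarith
    · have := (Int.lt_floor_add_one (t i / s)).le
      rw [div_le_iff₀ hs0] at this
      simp only [F]; linarith
  have hfin : (F '' K).Finite := by
    obtain ⟨R, hR⟩ := hK.isBounded.subset_closedBall 0
    have hsub : F '' K ⊆ (fun z : Fin d → ℤ => fun i => s * (z i : ℝ)) ''
        Set.Icc (fun _ => ⌊-R / s⌋) (fun _ => ⌊R / s⌋) := by
      rintro _ ⟨t, ht, rfl⟩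
      have htR : ∀ i, |t i| ≤ R := fun i =>
        (norm_le_pi_norm t i).trans (by simpa using hR ht)
      refine ⟨fun i => ⌊t i / s⌋, ⟨fun i => ?_, fun i => ?_⟩, rfl⟩
      · have := (abs_le.1 (htR i)).1
        exact Int.floor_mono (by gcongr)
      · have := (abs_le.1 (htR i)).2
        exact Int.floor_mono (by gcongr)
    exact ((Set.finite_Icc _ _).image _).subset hsub
  have hcubeU : ∀ a ∈ F '' K, (Set.Icc a fun i => a i + s) ⊆ U := by
    rintro _ ⟨t, ht, rfl⟩ y hy
    refine hδU (Metric.mem_thickening_iff.2 ⟨t, ht, ?_⟩)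
    refine ((dist_pi_le_iff hs0.le).2 fun i => ?_).trans_lt (half_lt_self hδ)
    have h1 := (hFmem t).1 i
    have h2 := (hFmem t).2 i
    have h3 := hy.1 i
    have h4 := hy.2 i
    simp only at h2 h4
    rw [Real.dist_eq, abs_le]
    constructor <;> linarith
  refine ⟨s, hs0, hfin.toFinset, ?_, fun t ht => ?_, ?_⟩
  · refine Set.iUnion₂_subset fun a ha => hcubeU a (by simpa using ha)
  · exact Set.mem_iUnion₂.2 ⟨F t, by simpa using ⟨t, ht, rfl⟩, hFmem t⟩
  · -- the half-open cubes are the fibres of `F`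
    have hfib : ∀ a ∈ F '' K, (Set.univ.pi fun i => Set.Ico (a i) (a i + s)) ⊆ F ⁻¹' {a} := by
      rintro _ ⟨t, ht, rfl⟩ y hy
      have : F y = F t := by
        ext i
        have hyi := hy i (Set.mem_univ i)
        simp only [F] at hyi ⊢
        congr 2
        rw [Int.floor_eq_iff, le_div_iff₀ hs0, div_lt_iff₀ hs0]
        constructor <;> nlinarith [hyi.1, hyi.2]
      exact this
    calc (hfin.toFinset.card : ℝ≥0∞) * ENNReal.ofReal (s ^ d)
        = ∑ a ∈ hfin.toFinset, volume (Set.univ.pi fun i => Set.Ico (a i) (a i + s)) := by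
          simp [Real.volume_pi_Ico, ENNReal.ofReal_pow hs0.le]
      _ = volume (⋃ a ∈ hfin.toFinset, Set.univ.pi fun i => Set.Ico (a i) (a i + s)) := by
          refine (measure_biUnion_finset (fun a ha b hb hab => ?_) fun a _ =>
            MeasurableSet.univ_pi fun i => measurableSet_Ico).symm
          have ha' : a ∈ F '' K := by simpa using ha
          have hb' : b ∈ F '' K := by simpa using hb
          rw [Function.onFun, Set.disjoint_left]
          intro y hya hyb
          exact hab ((hfib a ha' hya).symm.trans (hfib b hb' hyb))
      _ ≤ volume U := by
          refine measure_mono (Set.iUnion₂_subset fun a ha => ?_)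
          refine Set.Subset.trans (fun y hy => ?_) (hcubeU a (by simpa using ha))
          exact ⟨fun i => (hy i (Set.mem_univ i)).1, fun i => (hy i (Set.mem_univ i)).2.le⟩

/-- Cubes inside `A` carry almost all nodes and almost all of the volume of `A`; the rest of `A` is
served by a small proportion of the nodes, taken from a maximal packing. -/
theorem eventually_minCost_le (hd : 1 ≤ d) (hN : ∀ x, N x = 0 → x = 0) {A : Set (Fin d → ℝ)}
    (hA : IsJordanMeasurable A) {c : ℝ}
    (hc : cubeConst N * (volume A).toReal ^ (1 + 1 / (d : ℝ)) < c) :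
    ∀ᶠ n : ℕ in atTop, minCost N A n ≤ ENNReal.ofReal (c * (n : ℝ) ^ (-(1 / (d : ℝ)))) := by
  have hdR : (0 : ℝ) < d := by exact_mod_cast hd
  have hκ := cubeConst_nonneg N
  set a := (volume A).toReal with ha
  -- a small proportion `β` of the nodes is reserved for the part of `A` outside the cubes
  obtain ⟨β, hβ0, hβ1, hβ⟩ : ∃ β : ℝ, 0 < β ∧ β < 1 ∧
      cubeConst N * a ^ (1 + 1 / (d : ℝ)) * (1 - β) ^ (-(1 / (d : ℝ))) < c := by
    have hcont : ContinuousAt (fun β : ℝ => cubeConst N * a ^ (1 + 1 / (d : ℝ)) *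
        (1 - β) ^ (-(1 / (d : ℝ)))) 0 :=
      continuousAt_const.mul ((continuousAt_const.sub continuousAt_id).rpow_const
        (Or.inl (by simp)))
    have h0 : Tendsto (fun β : ℝ => cubeConst N * a ^ (1 + 1 / (d : ℝ)) *
        (1 - β) ^ (-(1 / (d : ℝ)))) (𝓝[>] 0) (𝓝 (cubeConst N * a ^ (1 + 1 / (d : ℝ)))) := by
      have := hcont.tendsto
      simp only [sub_zero, Real.one_rpow, mul_one] at this
      exact this.mono_left nhdsWithin_le_nhds
    obtain ⟨β, h1, h2⟩ := ((h0.eventually (gt_mem_nhds hc)).and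
      (Ioo_mem_nhdsGT (zero_lt_one (α := ℝ)))).exists
    exact ⟨β, h2.1, h2.2, h1⟩
  obtain ⟨c₁, hc₁, hc₁c⟩ := exists_between hβ
  obtain ⟨C, hC0, hC⟩ := exists_minCost_le_volume_mul hd hN hA.1
  obtain ⟨δ, hδ0, hδ⟩ : ∃ δ : ℝ, 0 < δ ∧ C * δ * β ^ (-(1 / (d : ℝ))) < c - c₁ := by
    have hpos : 0 < C * β ^ (-(1 / (d : ℝ))) := by positivity
    refine ⟨(c - c₁) / (C * β ^ (-(1 / (d : ℝ)))) / 2, ?_, ?_⟩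
    · have := sub_pos.2 hc₁c; positivity
    · have := sub_pos.2 hc₁c
      rw [show C * ((c - c₁) / (C * β ^ (-(1 / (d : ℝ)))) / 2) * β ^ (-(1 / (d : ℝ))) =
        (c - c₁) / 2 by field_simp]
      linarith
  obtain ⟨K, hKA, hK, hKδ⟩ := isOpen_interior.measurableSet.exists_isCompact_sdiff_lt
    (μ := volume) (((measure_mono interior_subset).trans_lt hA.volume_lt_top).ne)
    (ε := ENNReal.ofReal δ) (by simpa using hδ0)
  obtain ⟨s, hs0, J, hJA, hKJ, hJcard⟩ := exists_cubes_between hK isOpen_interior hKA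
  set G := ⋃ a ∈ J, Set.Icc a fun i => a i + s with hG
  have hGA : G ⊆ A := hJA.trans interior_subset
  have hrest : volume (A \ G) ≤ ENNReal.ofReal δ := by
    have hsub : A \ G ⊆ (interior A \ K) ∪ frontier A := by
      intro t ht
      by_cases hti : t ∈ interior A
      · exact Or.inl ⟨hti, fun h => ht.2 (hKJ h)⟩
      · exact Or.inr ⟨subset_closure ht.1, hti⟩
    refine (measure_mono hsub).trans ((measure_union_le _ _).trans ?_)
    rw [hA.2, add_zero]; exact hKδ.le
  have hvol : (J.card : ℝ) * s ^ d ≤ a := by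
    have h1 := hJcard.trans (measure_mono interior_subset)
    rw [← ENNReal.ofReal_natCast, ← ENNReal.ofReal_mul (by positivity)] at h1
    exact (ENNReal.ofReal_le_iff_le_toReal hA.volume_lt_top.ne).1 h1
  obtain ⟨c₂, hc₂, hc₂'⟩ : ∃ c₂, cubeConst N * a ^ (1 + 1 / (d : ℝ)) < c₂ ∧
      c₂ * (1 - β) ^ (-(1 / (d : ℝ))) < c₁ := by
    have hq : 0 < (1 - β) ^ (-(1 / (d : ℝ))) := Real.rpow_pos_of_pos (by linarith) _
    obtain ⟨c₂, h1, h2⟩ := exists_between ((lt_div_iff₀ hq).2 hc₁)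
    exact ⟨c₂, h1, (lt_div_iff₀ hq).1 h2⟩
  have hGlim := eventually_comp_le (sub_pos.2 hβ1) (tendsto_floor_mul_div (sub_pos.2 hβ1).le)
    (eventually_minCost_cubes_le hd J hs0 (N := N) (c := c₂) (lt_of_le_of_lt (by gcongr) hc₂)) hc₂'
  have hRlim : ∀ᶠ n : ℕ in atTop, minCost N (A \ G) n ≤
      ENNReal.ofReal (C * δ * (n : ℝ) ^ (-(1 / (d : ℝ)))) := by
    filter_upwards [hC] with n hn
    refine (hn _ Set.sdiff_subset).trans ?_
    rw [mul_right_comm, ENNReal.ofReal_mul (q := δ) (by positivity)]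
    gcongr
  have hRlim' := eventually_comp_le hβ0 (tendsto_floor_mul_div hβ0.le) hRlim hδ
  filter_upwards [hGlim, hRlim'] with n h1 h2
  have hle : ⌊(1 - β) * (n : ℝ)⌋₊ + ⌊β * (n : ℝ)⌋₊ ≤ n := by
    have e1 := Nat.floor_le (show 0 ≤ (1 - β) * (n : ℝ) from
      mul_nonneg (sub_pos.2 hβ1).le (Nat.cast_nonneg n))
    have e2 := Nat.floor_le (show 0 ≤ β * (n : ℝ) by positivity)
    have : ((⌊(1 - β) * (n : ℝ)⌋₊ + ⌊β * (n : ℝ)⌋₊ : ℕ) : ℝ) ≤ n := by push_cast; linarith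
    exact_mod_cast this
  have hAG : A = G ∪ A \ G := (Set.union_sdiff_cancel hGA).symm
  have hsub := minCost_union_le (N := N) G (A \ G) ⌊(1 - β) * (n : ℝ)⌋₊ ⌊β * (n : ℝ)⌋₊
  rw [← hAG] at hsub
  refine (minCost_anti A hle).trans (hsub.trans ((add_le_add h1 h2).trans ?_))
  have hc₁0 : 0 ≤ c₁ := le_trans (by have := sub_pos.2 hβ1; positivity) hc₁.le
  rw [← ENNReal.ofReal_add (mul_nonneg hc₁0 (by positivity))
    (mul_nonneg (sub_pos.2 hc₁c).le (by positivity))]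
  refine ENNReal.ofReal_le_ofReal (le_of_eq ?_)
  ring

end Upper

/-! ### Asymptotic lower bound and the limit -/

section Lower

variable {d : ℕ} {N : Seminorm ℝ (Fin d → ℝ)}

theorem IsJordanMeasurable.icc_diff {D : Set (Fin d → ℝ)} (hD : IsJordanMeasurable D)
    (a b : Fin d → ℝ) : IsJordanMeasurable (Set.Icc a b \ D) := by
  refine ⟨(Metric.isBounded_Icc a b).subset Set.sdiff_subset, ?_⟩
  rw [Set.sdiff_eq]
  exact null_frontier_inter ((convex_Icc a b).addHaar_frontier volume)
    (by rw [frontier_compl]; exact hD.2)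

/-- The lower bound follows from the upper bound for the complement of `D` in a cube, since good
nodes for `D` and for its complement together cannot beat the constant of the cube. -/
theorem eventually_le_minCost (hd : 1 ≤ d) (hN : ∀ x, N x = 0 → x = 0) {D : Set (Fin d → ℝ)}
    (hD : IsJordanDomain D) {c : ℝ}
    (hc : c < cubeConst N * (volume D).toReal ^ (1 + 1 / (d : ℝ))) :
    ∀ᶠ n : ℕ in atTop, ENNReal.ofReal (c * (n : ℝ) ^ (-(1 / (d : ℝ)))) ≤ minCost N D n := by
  have hdR : (0 : ℝ) < d := by exact_mod_cast hd
  have hκ := cubeConst_nonneg N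
  have hDfin := hD.1.volume_lt_top
  set a := (volume D).toReal with ha
  have ha0 : 0 < a := ENNReal.toReal_pos hD.volume_pos.ne' hDfin.ne
  obtain ⟨R, hR⟩ := hD.1.1.subset_closedBall 0
  obtain ⟨s, hs0, hsR, hsa⟩ : ∃ s : ℝ, 0 < s ∧ 2 * R ≤ s ∧ a < s ^ d := by
    refine ⟨max (2 * R) (a + 1), lt_max_of_lt_right (by positivity), le_max_left _ _, ?_⟩
    have h1 : a + 1 ≤ max (2 * R) (a + 1) := le_max_right _ _
    have h2 : max (2 * R) (a + 1) ≤ max (2 * R) (a + 1) ^ d :=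
      le_self_pow₀ (by linarith) (by omega)
    linarith
  set q : Fin d → ℝ := fun _ => -R with hq
  set Q := Set.Icc q fun i => q i + s with hQ
  have hDQ : D ⊆ Q := fun t ht => by
    have htR : ∀ i, |t i| ≤ R := fun i =>
      (norm_le_pi_norm t i).trans (by simpa using hR ht)
    refine ⟨fun i => (abs_le.1 (htR i)).1, fun i => ?_⟩
    have := (abs_le.1 (htR i)).2
    simp only [hq]; linarith
  have hQvol : volume Q = ENNReal.ofReal (s ^ d) := by
    simp [hQ, Real.volume_Icc_pi, ENNReal.ofReal_pow hs0.le]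
  have hCvol : (volume (Q \ D)).toReal = s ^ d - a := by
    rw [measure_sdiff hDQ hD.1.nullMeasurableSet hDfin.ne, hQvol,
      ENNReal.toReal_sub_of_le (by rw [← hQvol]; exact measure_mono hDQ) ENNReal.ofReal_ne_top,
      ENNReal.toReal_ofReal (by positivity)]
  set V := s ^ d with hV
  have hV0 : 0 < V := by positivity
  set b := V - a with hb
  have hb0 : 0 < b := sub_pos.2 hsa
  -- the nodes are divided between `D` and `Q \ D` in proportion to the volumes
  set γ := b / a with hγ
  have hγ0 : 0 < γ := by positivity
  have hsV : s = V ^ (1 / (d : ℝ)) := by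
    rw [hV, ← Real.rpow_natCast, ← Real.rpow_mul hs0.le, mul_one_div_cancel hdR.ne', Real.rpow_one]
  have hneg : ∀ x : ℝ, 0 < x → (x / a) ^ (-(1 / (d : ℝ))) =
      a ^ (1 / (d : ℝ)) / x ^ (1 / (d : ℝ)) := fun x hx => by
    rw [Real.rpow_neg (by positivity), Real.div_rpow hx.le ha0.le, inv_div]
  have hpow : ∀ x : ℝ, 0 < x → x ^ (1 + 1 / (d : ℝ)) = x * x ^ (1 / (d : ℝ)) := fun x hx => by
    rw [Real.rpow_add hx, Real.rpow_one]
  set A := a ^ (1 / (d : ℝ)) with hA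
  set gap := cubeConst N * (a * A) - c with hgap
  have hgap0 : 0 < gap := by rw [hgap, hA, ← hpow a ha0]; linarith
  obtain ⟨c₁, hc₁, hc₁'⟩ : ∃ c₁, cubeConst N * b ^ (1 + 1 / (d : ℝ)) < c₁ ∧
      c₁ * γ ^ (-(1 / (d : ℝ))) < cubeConst N * b * A + gap / 2 := by
    have hpos : 0 < γ ^ (-(1 / (d : ℝ))) := by positivity
    have h1 : cubeConst N * b ^ (1 + 1 / (d : ℝ)) <
        (cubeConst N * b * A + gap / 2) / γ ^ (-(1 / (d : ℝ))) := by
      rw [lt_div_iff₀ hpos, hγ, hneg b hb0, hpow b hb0]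
      have : cubeConst N * (b * b ^ (1 / (d : ℝ))) * (A / b ^ (1 / (d : ℝ))) =
        cubeConst N * b * A := by
        have : b ^ (1 / (d : ℝ)) ≠ 0 := by positivity
        field_simp
      linarith
    obtain ⟨c₁, h2, h3⟩ := exists_between h1
    exact ⟨c₁, h2, (lt_div_iff₀ hpos).1 h3⟩
  have hcompl := eventually_comp_le hγ0 (tendsto_floor_mul_div hγ0.le)
    (eventually_minCost_le hd hN (hD.1.icc_diff q fun i => q i + s) (c := c₁)
      (by rw [hCvol]; exact hc₁)) hc₁'
  have hlim : Tendsto (fun n : ℕ => ((n + ⌊γ * (n : ℝ)⌋₊ : ℕ) : ℝ) / n) atTop (𝓝 (V / a)) := by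
    have h1 : V / a = 1 + γ := by rw [hγ, hb]; field_simp; ring
    rw [h1]
    refine ((tendsto_floor_mul_div hγ0.le).const_add 1).congr' ?_
    filter_upwards [eventually_ge_atTop 1] with n hn
    have : (n : ℝ) ≠ 0 := by positivity
    push_cast
    field_simp
  have hcube := (tendsto_rpow_comp_div (p := -(1 / (d : ℝ))) (by positivity) hlim).const_mul
    (cubeConst N * s ^ (d + 1))
  have hcube' : cubeConst N * b * A + gap / 2 + c <
      cubeConst N * s ^ (d + 1) * (V / a) ^ (-(1 / (d : ℝ))) := by
    rw [hneg V hV0, pow_succ, ← hV, ← hsV]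
    have : cubeConst N * (V * s) * (A / s) = cubeConst N * b * A + cubeConst N * (a * A) := by
      rw [hb]; field_simp; ring
    rw [this]; linarith
  filter_upwards [hcompl, hcube.eventually (lt_mem_nhds hcube'), eventually_ge_atTop 1]
    with n h1 h2 hn
  have hn0 : (0 : ℝ) < n := by exact_mod_cast hn
  have h3 := minCost_union_le (N := N) D (Q \ D) n ⌊γ * (n : ℝ)⌋₊
  rw [Set.union_sdiff_cancel hDQ] at h3
  have h4 := (le_minCost_cube (N := N) q hs0 (n := n + ⌊γ * (n : ℝ)⌋₊) (by omega)).trans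
    (h3.trans (add_le_add le_rfl h1))
  have hnp : 0 < (n : ℝ) ^ (-(1 / (d : ℝ))) := by positivity
  rw [← mul_div_assoc, lt_div_iff₀ hnp] at h2
  have h5 := (ENNReal.ofReal_le_ofReal h2.le).trans h4
  have hnn : 0 ≤ (cubeConst N * b * A + gap / 2) * (n : ℝ) ^ (-(1 / (d : ℝ))) := by positivity
  rw [← tsub_le_iff_right, ← ENNReal.ofReal_sub _ hnn] at h5
  refine le_trans (le_of_eq ?_) h5
  congr 1; ring

theorem minCost_ne_top {D : Set (Fin d → ℝ)} (hD : Bornology.IsBounded D) (hne : D.Nonempty)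
    {n : ℕ} (hn : 1 ≤ n) : minCost N D n ≠ ∞ := by
  obtain ⟨C, hC, h⟩ := N.exists_le_mul_norm
  obtain ⟨y, hy⟩ := hne
  obtain ⟨R, hR⟩ := hD.subset_closedBall y
  refine ((minCost_le (S := {y}) (by simpa) (by simpa using hn)).trans
    (setLIntegral_mono (g := fun _ => ENNReal.ofReal (C * R)) measurable_const
      fun t ht => ?_)).trans_lt ?_ |>.ne
  · refine (distTo_le_of_mem (Finset.mem_singleton_self y) t).trans (ENNReal.ofReal_le_ofReal ?_)
    refine (h _).trans ?_
    gcongr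
    rw [← dist_eq_norm]; exact hR ht
  · rw [setLIntegral_const]
    exact ENNReal.mul_lt_top ENNReal.ofReal_lt_top hD.measure_lt_top

theorem tendsto_minCost (hd : 1 ≤ d) (hN : ∀ x, N x = 0 → x = 0) {D : Set (Fin d → ℝ)}
    (hD : IsJordanDomain D) :
    Tendsto (fun n : ℕ => (minCost N D n).toReal / (n : ℝ) ^ (-(1 / (d : ℝ)))) atTop
      (𝓝 (cubeConst N * (volume D).toReal ^ (1 + 1 / (d : ℝ)))) := by
  have hfin : ∀ n : ℕ, 1 ≤ n → minCost N D n ≠ ∞ := fun n hn => minCost_ne_top hD.1.1 hD.nonempty hn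
  refine tendsto_order.2 ⟨fun c hc => ?_, fun c hc => ?_⟩
  · obtain ⟨c', h1, h2⟩ := exists_between hc
    filter_upwards [eventually_le_minCost hd hN hD h2, eventually_ge_atTop 1] with n h hn
    have hnp : 0 < (n : ℝ) ^ (-(1 / (d : ℝ))) := by positivity
    refine h1.trans_le ?_
    rw [le_div_iff₀ hnp]
    exact (ENNReal.ofReal_le_iff_le_toReal (hfin n hn)).1 h
  · obtain ⟨c', h1, h2⟩ := exists_between hc
    filter_upwards [eventually_minCost_le hd hN hD.1 h1, eventually_ge_atTop 1] with n h hn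
    have hnp : 0 < (n : ℝ) ^ (-(1 / (d : ℝ))) := by positivity
    refine lt_of_le_of_lt ?_ h2
    rw [div_le_iff₀ hnp]
    have hc0 : 0 ≤ c' := le_trans (by have := cubeConst_nonneg N; positivity) h1.le
    exact ENNReal.toReal_le_of_le_ofReal (by positivity) h

theorem le_cubeConst (hd : 1 ≤ d) (hN : ∀ x, N x = 0 → x = 0) :
    (d : ℝ) / (d + 1) ≤ cubeConst N * (volume (unitBall N)).toReal ^ (1 / (d : ℝ)) := by
  have hdR : (0 : ℝ) < d := by exact_mod_cast hd
  have hvfin := (volume_unitBall_lt_top hN).ne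
  set v := (volume (unitBall N)).toReal with hv
  have hv0 : 0 < v := ENNReal.toReal_pos (volume_unitBall_pos N).ne' hvfin
  have hvp : 0 < v ^ (1 / (d : ℝ)) := by positivity
  rw [← div_le_iff₀ hvp]
  refine le_ciInf fun m => ?_
  set n := m + 1 with hn
  have hn0 : (0 : ℝ) < (n : ℕ) := by positivity
  set ρ : ℝ := ((n : ℝ) * v) ^ (-(1 / (d : ℝ))) with hρ
  have hρ0 : 0 < ρ := by positivity
  have hρd : ρ ^ d = ((n : ℝ) * v)⁻¹ := by
    rw [hρ, ← Real.rpow_natCast, ← Real.rpow_mul (by positivity), neg_mul,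
      one_div_mul_cancel hdR.ne', Real.rpow_neg_one]
  have hvolQ : volume (Set.Icc (0 : Fin d → ℝ) 1) = 1 := by simp [Real.volume_Icc_pi]
  have h := le_minCost (N := N) (A := Set.Icc (0 : Fin d → ℝ) 1) (n := n) (by simp [hvolQ]) hρ0 (by
    rw [hvolQ, ← ENNReal.ofReal_toReal hvfin, ← hv, ← ENNReal.ofReal_natCast,
      ← ENNReal.ofReal_mul (by positivity), ← ENNReal.ofReal_mul (by positivity), hρd]
    rw [show (n : ℝ) * (((n : ℝ) * v)⁻¹ * v) = 1 by field_simp, ENNReal.ofReal_one])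
  rw [hvolQ, mul_one] at h
  have h' := (ENNReal.ofReal_le_iff_le_toReal (minCost_unitCube_ne_top N (by omega))).1 h
  rw [mul_comm, ← div_le_iff₀ (by positivity)]
  refine le_trans (le_of_eq ?_) h'
  rw [hρ, Real.rpow_neg (by positivity), Real.mul_rpow hn0.le hv0.le]
  field_simp

end Lower

/-! ### The upper bound by the covering constant -/

section CoveringUpper

variable {d : ℕ} {N : Seminorm ℝ (Fin d → ℝ)}

theorem cubeConst_le_of_cover (hd : 1 ≤ d) {R : ℝ} (hR : 0 < R) {S : Finset (Fin d → ℝ)}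
    (hS : (S : Set (Fin d → ℝ)) ⊆ Set.Icc (fun _ => -R) fun _ => R)
    (hcov : ∀ t ∈ Set.Icc (fun _ => -R : Fin d → ℝ) fun _ => R, ∃ x ∈ S, t ∈ N.closedBall x 1) :
    cubeConst N ≤ (d : ℝ) / (d + 1) * (S.card / (2 * R) ^ d) ^ (1 / (d : ℝ)) := by
  have hdR : (0 : ℝ) < d := by exact_mod_cast hd
  have hne : S.Nonempty := by
    obtain ⟨x, hx, -⟩ := hcov 0 ⟨fun _ => by simpa using hR.le, fun _ => hR.le⟩
    exact ⟨x, hx⟩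
  have hn0 : (0 : ℝ) < S.card := by exact_mod_cast hne.card_pos
  have h1 := nodeCost_le_of_cover (convex_Icc _ _) measurableSet_Icc
    (by rw [volume_Icc_cube]; exact ENNReal.pow_ne_top ENNReal.ofReal_ne_top) hS hne one_pos hcov
  have h2 := (le_minCost_cube (N := N) (fun _ => -R) (s := 2 * R) (by positivity)
    (n := S.card) hne.card_pos)
  have hQ : (Set.Icc (fun _ => -R : Fin d → ℝ) fun _ => -R + 2 * R) =
      Set.Icc (fun _ => -R) fun _ => R := by
    congr 1; funext _; ring
  rw [hQ] at h2
  have h3 := h2.trans ((minCost_le hS le_rfl).trans h1)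
  rw [volume_Icc_cube, ← ENNReal.ofReal_pow (by positivity), ← ENNReal.ofReal_mul (by positivity),
    ENNReal.ofReal_le_ofReal_iff (by positivity), Real.rpow_neg hn0.le, mul_one] at h3
  have hp : 0 < (S.card : ℝ) ^ (1 / (d : ℝ)) := by positivity
  rw [Real.div_rpow hn0.le (by positivity), ← Real.rpow_natCast (2 * R) d,
    ← Real.rpow_mul (by positivity), mul_one_div_cancel hdR.ne', Real.rpow_one,
    ← mul_div_assoc, le_div_iff₀ (by positivity)]
  rw [← div_eq_mul_inv, div_le_iff₀ hp, pow_succ] at h3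
  have hpow : 0 < (2 * R) ^ d := by positivity
  nlinarith

theorem mem_cube_iff_norm_le {R : ℝ} (hR : 0 ≤ R) {t : Fin d → ℝ} :
    t ∈ Set.Icc (fun _ => -R : Fin d → ℝ) (fun _ => R) ↔ ‖t‖ ≤ R := by
  rw [pi_norm_le_iff_of_nonneg hR]
  simp only [Real.norm_eq_abs, abs_le, Set.mem_Icc, Pi.le_def, forall_and]

/-- The points of a covering set that lie in a large cube do not cover the points near its boundary,
but additional centres in the cube, whose number is bounded by the volume of a boundary layer of
fixed width, complete them to a covering of the cube by unit balls centred in it. -/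
theorem exists_cover_cube_card_le {c : ℝ} (hc0 : 0 < c) (hc : ∀ x, ‖x‖ ≤ c * N x)
    {X : Set (Fin d → ℝ)} (hX : IsCoveringSet N X) {R : ℝ} (hR : 2 * c ≤ R)
    (hfin : (X ∩ Set.Icc (fun _ => -R) fun _ => R).Finite) :
    ∃ S : Finset (Fin d → ℝ), (S : Set (Fin d → ℝ)) ⊆ Set.Icc (fun _ => -R) (fun _ => R) ∧
      (∀ t ∈ Set.Icc (fun _ => -R : Fin d → ℝ) fun _ => R, ∃ x ∈ S, t ∈ N.closedBall x 1) ∧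
      (S.card : ℝ) ≤ hfin.toFinset.card + ((2 * (R + c)) ^ d - (2 * (R - 2 * c)) ^ d) /
        ((1 / 2) ^ d * (volume (unitBall N)).toReal) := by
  classical
  have hN : ∀ x, N x = 0 → x = 0 := fun x hx => by
    have := hc x
    rw [hx, mul_zero] at this
    exact norm_le_zero_iff.1 this
  have hvfin := (volume_unitBall_lt_top hN).ne
  set v := (volume (unitBall N)).toReal with hv
  have hv0 : 0 < v := ENNReal.toReal_pos (volume_unitBall_pos N).ne' hvfin
  set Q : ℝ → Set (Fin d → ℝ) := fun R => Set.Icc (fun _ => -R) fun _ => R with hQ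
  have hQR : ∀ {r : ℝ}, 0 ≤ r → ∀ t, t ∈ Q r ↔ ‖t‖ ≤ r := fun hr t => mem_cube_iff_norm_le hr
  have hQvol : ∀ {r : ℝ}, 0 ≤ r → volume (Q r) = ENNReal.ofReal ((2 * r) ^ d) := fun hr => by
    rw [hQ, volume_Icc_cube, ENNReal.ofReal_pow (by positivity)]
  have hshell : ∀ x ∈ Q R \ Q (R - c), N.closedBall x (1 / 2) ⊆ Q (R + c) \ Q (R - 2 * c) := by
    intro x hx y hy
    rw [Seminorm.mem_closedBall] at hy
    have hyx : ‖y - x‖ ≤ c := (hc _).trans (by nlinarith)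
    have hx1 : ‖x‖ ≤ R := (hQR (by linarith) x).1 hx.1
    have hx2 : ¬ ‖x‖ ≤ R - c := fun h => hx.2 ((hQR (by linarith) x).2 h)
    have h1 : ‖y‖ ≤ ‖y - x‖ + ‖x‖ := by simpa using norm_add_le (y - x) x
    have h2 : ‖x‖ ≤ ‖y - x‖ + ‖y‖ := by
      rw [norm_sub_rev]; simpa using norm_add_le (x - y) y
    refine ⟨(hQR (by linarith) y).2 (by linarith), fun hy' => hx2 ?_⟩
    have := (hQR (by linarith) y).1 hy'
    linarith
  have hWvol : volume (Q (R + c) \ Q (R - 2 * c)) =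
      ENNReal.ofReal ((2 * (R + c)) ^ d - (2 * (R - 2 * c)) ^ d) := by
    rw [measure_sdiff (fun t ht => (hQR (by linarith) t).2
      (((hQR (by linarith) t).1 ht).trans (by linarith))) measurableSet_Icc.nullMeasurableSet
      (by rw [hQvol (by linarith)]; exact ENNReal.ofReal_ne_top), hQvol (by linarith),
      hQvol (by linarith), ENNReal.ofReal_sub _ (pow_nonneg (by linarith) d)]
  obtain ⟨S, hSA, hcov, hcard⟩ := exists_cover_card_mul_le (N := N) (by norm_num : (0 : ℝ) < 1 / 2)
    hshell (by rw [hWvol]; exact ENNReal.ofReal_ne_top)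
  refine ⟨hfin.toFinset ∪ S, ?_, fun t ht => ?_, ?_⟩
  · rw [Finset.coe_union, Set.Finite.coe_toFinset]
    exact Set.union_subset Set.inter_subset_right (hSA.trans Set.sdiff_subset)
  · by_cases hti : t ∈ Q (R - c)
    · obtain ⟨x, hxX, hx⟩ := hX t
      have hx1 : N (t - x) ≤ 1 := hx
      refine ⟨x, Finset.mem_union_left _ ((Set.Finite.mem_toFinset _).2 ⟨hxX, ?_⟩), hx1⟩
      refine (hQR (by linarith) x).2 ?_
      have h1 : ‖x‖ ≤ ‖t - x‖ + ‖t‖ := by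
        rw [norm_sub_rev]; simpa using norm_add_le (x - t) t
      have h2 := (hQR (by linarith) t).1 hti
      have h3 := (hc (t - x)).trans (mul_le_of_le_one_right hc0.le hx1)
      linarith
    · obtain ⟨x, hxS, hx⟩ := hcov t ⟨ht, hti⟩
      exact ⟨x, Finset.mem_union_right _ hxS, by simpa using hx⟩
  · have h1 : ((hfin.toFinset ∪ S).card : ℝ) ≤ hfin.toFinset.card + S.card := by
      exact_mod_cast Finset.card_union_le _ _
    refine h1.trans (add_le_add le_rfl ?_)
    rw [hWvol, ← ENNReal.ofReal_toReal hvfin, ← hv, ← ENNReal.ofReal_natCast,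
      ← ENNReal.ofReal_mul (by positivity), ← ENNReal.ofReal_mul (by positivity),
      ENNReal.ofReal_le_ofReal_iff (sub_nonneg.2 (pow_le_pow_left₀ (by linarith)
        (by linarith) d))] at hcard
    rw [le_div_iff₀ (by positivity)]
    exact hcard

/-- The boundary layer of the cube of side `2 * R` contributes only `e R → 0` to the density. -/
theorem cubeConst_le_of_systemDensity_lt (hd : 1 ≤ d) (hN : ∀ x, N x = 0 → x = 0)
    {X : Set (Fin d → ℝ)} (hX : IsCoveringSet N X) {θ : ℝ} (hθ0 : 0 ≤ θ)
    (hθ : systemDensity N X < ENNReal.ofReal θ) :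
    cubeConst N * (volume (unitBall N)).toReal ^ (1 / (d : ℝ)) ≤
      (d : ℝ) / (d + 1) * θ ^ (1 / (d : ℝ)) := by
  have hdR : (0 : ℝ) < d := by exact_mod_cast hd
  obtain ⟨c, hc0, hc⟩ := Seminorm.exists_norm_le_mul hN
  have hvfin := (volume_unitBall_lt_top hN).ne
  set v := (volume (unitBall N)).toReal with hv
  have hv0 : 0 < v := ENNReal.toReal_pos (volume_unitBall_pos N).ne' hvfin
  have hvE : volume (unitBall N) = ENNReal.ofReal v := (ENNReal.ofReal_toReal hvfin).symm
  -- the density is a lower limit, so that only arbitrarily large `R`, not all, can be used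
  have hfreq := (frequently_lt_of_liminf_lt (by isBoundedDefault) hθ).and_eventually
    ((eventually_ge_atTop (2 * c)).and (eventually_gt_atTop 0))
  set e : ℝ → ℝ := fun R => ((1 + c / R) ^ d - (1 - 2 * c / R) ^ d) / ((1 / 2) ^ d * v) with he
  have hcR : ∀ k : ℝ, Tendsto (fun R : ℝ => k / R) atTop (𝓝 0) := fun k =>
    tendsto_const_nhds.div_atTop tendsto_id
  have helim : Tendsto e atTop (𝓝 0) := by
    have h := ((((hcR c).const_add 1).pow d).sub (((hcR (2 * c)).const_sub 1).pow d)).div_const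
      ((1 / 2) ^ d * v)
    simp only [add_zero, sub_zero, one_pow, sub_self, zero_div] at h
    exact h
  have hbound : ∃ᶠ R in atTop, cubeConst N ≤ (d : ℝ) / (d + 1) * (θ / v + e R) ^ (1 / (d : ℝ)) := by
    refine hfreq.mono fun R hR => ?_
    obtain ⟨hRθ, hRc, hR0⟩ := hR
    have hRd : 0 < (2 * R) ^ d := by positivity
    have hfin : (X ∩ Set.Icc (fun _ => -R) fun _ => R).Finite := by
      by_contra hinf
      rw [volume_Icc_cube, Set.Infinite.encard_eq hinf] at hRθ
      rw [ENat.toENNReal_top, ENNReal.top_mul (volume_unitBall_pos N).ne',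
        ENNReal.top_div_of_ne_top (ENNReal.pow_ne_top ENNReal.ofReal_ne_top)] at hRθ
      exact not_top_lt hRθ
    have hcard : (hfin.toFinset.card : ℝ) / (2 * R) ^ d ≤ θ / v := by
      rw [hfin.encard_eq_coe_toFinset_card, volume_Icc_cube, hvE,
        ← ENNReal.ofReal_pow (by positivity)] at hRθ
      rw [ENat.toENNReal_coe, ← ENNReal.ofReal_natCast,
        ← ENNReal.ofReal_mul (Nat.cast_nonneg _), ← ENNReal.ofReal_div_of_pos hRd,
        ENNReal.ofReal_lt_ofReal_iff_of_nonneg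
          (div_nonneg (mul_nonneg (Nat.cast_nonneg _) hv0.le) hRd.le)] at hRθ
      rw [le_div_iff₀ hv0, div_mul_eq_mul_div]
      exact hRθ.le
    obtain ⟨S, hS, hcov, hScard⟩ := exists_cover_cube_card_le hc0 hc hX hRc hfin
    refine (cubeConst_le_of_cover hd hR0 hS hcov).trans ?_
    refine mul_le_mul_of_nonneg_left (Real.rpow_le_rpow
      (div_nonneg (Nat.cast_nonneg _) hRd.le) ?_ (by positivity)) (by positivity)
    calc (S.card : ℝ) / (2 * R) ^ d
        ≤ (hfin.toFinset.card + ((2 * (R + c)) ^ d - (2 * (R - 2 * c)) ^ d) /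
            ((1 / 2) ^ d * v)) / (2 * R) ^ d := by gcongr
      _ = hfin.toFinset.card / (2 * R) ^ d + e R := by
          rw [add_div, he]
          congr 1
          have h1 : 1 + c / R = (2 * (R + c)) / (2 * R) := by field_simp
          have h2 : 1 - 2 * c / R = (2 * (R - 2 * c)) / (2 * R) := by field_simp
          simp only
          rw [h1, h2, div_pow _ (2 * R), div_pow _ (2 * R), ← sub_div, div_right_comm]
      _ ≤ θ / v + e R := by gcongr
  have hlim : Tendsto (fun R => (d : ℝ) / (d + 1) * (θ / v + e R) ^ (1 / (d : ℝ))) atTop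
      (𝓝 ((d : ℝ) / (d + 1) * (θ / v + 0) ^ (1 / (d : ℝ)))) :=
    ((helim.const_add _).rpow_const (Or.inr (by positivity))).const_mul _
  have hle := ge_of_tendsto_of_frequently hlim hbound
  rw [add_zero, Real.div_rpow hθ0 hv0.le, ← mul_div_assoc, le_div_iff₀ (by positivity)] at hle
  exact hle

end CoveringUpper

/-! ### Rogers' bound for the covering constant -/

section Rogers

variable {d : ℕ} {N : Seminorm ℝ (Fin d → ℝ)}

/-- Repeating a finite covering of a cube periodically gives a covering of the whole space. -/
theorem coveringConstant_le_of_cover (hN : ∀ x, N x = 0 → x = 0) {R : ℝ} (hR : 0 < R)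
    {S : Finset (Fin d → ℝ)}
    (hcov : ∀ t ∈ Set.Icc (fun _ => -R : Fin d → ℝ) fun _ => R, ∃ x ∈ S, t ∈ N.closedBall x 1) :
    coveringConstant N ≤ S.card * volume (unitBall N) / ENNReal.ofReal ((2 * R) ^ d) := by
  classical
  set G : (Fin d → ℝ) × (Fin d → ℤ) → (Fin d → ℝ) := fun p i => p.1 i + 2 * R * (p.2 i : ℝ) with hG
  set X : Set (Fin d → ℝ) := G '' ((S : Set (Fin d → ℝ)) ×ˢ Set.univ) with hXdef
  have h2R : 0 < 2 * R := by positivity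
  have hX : IsCoveringSet N X := by
    intro y
    set z : Fin d → ℤ := fun i => ⌊(y i + R) / (2 * R)⌋ with hz
    have hmem : (fun i => y i - 2 * R * (z i : ℝ)) ∈
        Set.Icc (fun _ => -R : Fin d → ℝ) fun _ => R := by
      refine ⟨fun i => ?_, fun i => ?_⟩
      · have := Int.floor_le ((y i + R) / (2 * R))
        rw [le_div_iff₀ h2R] at this
        simp only [hz]; linarith
      · have := (Int.lt_floor_add_one ((y i + R) / (2 * R))).le
        rw [div_le_iff₀ h2R] at this
        simp only [hz]; linarith
    obtain ⟨x, hx, hxy⟩ := hcov _ hmem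
    refine ⟨G (x, z), ⟨(x, z), ⟨hx, Set.mem_univ _⟩, rfl⟩, ?_⟩
    have : y - G (x, z) = (fun i => y i - 2 * R * (z i : ℝ)) - x := by
      ext i; simp only [hG, Pi.sub_apply]; ring
    rw [this]
    exact hxy
  refine (iInf₂_le X hX).trans ?_
  obtain ⟨b, hb0, hb⟩ : ∃ b : ℝ, 0 < b ∧ ∀ x ∈ S, ‖x‖ ≤ b := by
    refine ⟨∑ x ∈ S, ‖x‖ + 1, by positivity, fun x hx => ?_⟩
    have := Finset.single_le_sum (f := fun x => ‖x‖) (fun _ _ => norm_nonneg _) hx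
    linarith
  have hcount : ∀ T : ℝ, 0 < T → ((X ∩ Set.Icc (fun _ => -T) (fun _ => T)).encard : ℝ≥0∞) ≤
      ENNReal.ofReal (S.card * ((T + b) / R + 1) ^ d) := by
    intro T hT
    set k : ℕ := ⌊(T + b) / (2 * R)⌋₊ with hk
    have hsub : X ∩ Set.Icc (fun _ => -T) (fun _ => T) ⊆
        ((S ×ˢ Fintype.piFinset fun _ => Finset.Icc (-(k : ℤ)) k).image G :
          Finset (Fin d → ℝ)) := by
      rintro _ ⟨⟨⟨x, z⟩, ⟨hx, -⟩, rfl⟩, h0, h1⟩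
      refine Finset.mem_coe.2 (Finset.mem_image.2 ⟨(x, z), Finset.mem_product.2 ⟨hx,
        Fintype.mem_piFinset.2 fun i => Finset.mem_Icc.2 (abs_le.1 ?_)⟩, rfl⟩)
      have hxi := abs_le.1 ((norm_le_pi_norm x i).trans (hb x hx))
      have h0i := h0 i
      have h1i := h1 i
      simp only [hG] at h0i h1i
      have hz : |(z i : ℝ)| ≤ (T + b) / (2 * R) := by
        rw [abs_le, le_div_iff₀ h2R, ← neg_div, div_le_iff₀ h2R]
        constructor <;> linarith
      have hz' : (((z i).natAbs : ℕ) : ℝ) ≤ (T + b) / (2 * R) := by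
        rwa [Nat.cast_natAbs, Int.cast_abs]
      have := Nat.le_floor hz'
      rw [Int.abs_eq_natAbs]
      exact_mod_cast this
    have hcardF : (((S ×ˢ Fintype.piFinset fun _ : Fin d => Finset.Icc (-(k : ℤ)) k).image G).card
        : ℝ) ≤ S.card * ((T + b) / R + 1) ^ d := by
      have h1 : ((S ×ˢ Fintype.piFinset fun _ : Fin d => Finset.Icc (-(k : ℤ)) k).image G).card ≤
          S.card * (2 * k + 1) ^ d := by
        refine Finset.card_image_le.trans (le_of_eq ?_)
        rw [Finset.card_product, Fintype.card_piFinset]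
        simp only [Int.card_Icc, Finset.prod_const, Finset.card_univ, Fintype.card_fin]
        congr 2
        omega
      have h2 : (2 * k + 1 : ℝ) ≤ (T + b) / R + 1 := by
        have := Nat.floor_le (show 0 ≤ (T + b) / (2 * R) by positivity)
        rw [← hk, le_div_iff₀ h2R] at this
        rw [add_le_add_iff_right, le_div_iff₀ hR]
        linarith
      calc _ ≤ ((S.card * (2 * k + 1) ^ d : ℕ) : ℝ) := by exact_mod_cast h1
        _ = S.card * (2 * k + 1 : ℝ) ^ d := by push_cast; ring
        _ ≤ _ := by gcongr
    have henc := Set.encard_le_encard hsub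
    rw [Set.encard_coe_eq_coe_finsetCard] at henc
    refine (ENat.toENNReal_mono henc).trans ?_
    rw [ENat.toENNReal_coe, ← ENNReal.ofReal_natCast]
    exact ENNReal.ofReal_le_ofReal hcardF
  -- the density is estimated by a convergent function of the size `T` of the window
  have hlim : Tendsto (fun T : ℝ => ENNReal.ofReal (S.card * ((1 + b / T) / (2 * R) +
      1 / 2 / T) ^ d) * volume (unitBall N)) atTop
      (𝓝 (ENNReal.ofReal (S.card * ((1 + 0) / (2 * R) + 0) ^ d) * volume (unitBall N))) := by
    have hcR : ∀ k : ℝ, Tendsto (fun R : ℝ => k / R) atTop (𝓝 0) := fun k =>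
      tendsto_const_nhds.div_atTop tendsto_id
    refine ENNReal.Tendsto.mul_const (ENNReal.tendsto_ofReal ?_)
      (Or.inr (volume_unitBall_lt_top hN).ne)
    exact (((((hcR b).const_add 1).div_const (2 * R)).add (hcR (1 / 2))).pow d).const_mul _
  calc systemDensity N X
      ≤ liminf (fun T : ℝ => ENNReal.ofReal (S.card * ((1 + b / T) / (2 * R) + 1 / 2 / T) ^ d) *
          volume (unitBall N)) atTop := by
        refine liminf_le_liminf ?_
        filter_upwards [eventually_gt_atTop 0] with T hT
        have hTd : 0 < (2 * T) ^ d := by positivity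
        rw [volume_Icc_cube, ← ENNReal.ofReal_pow (by positivity), ENNReal.mul_div_right_comm]
        gcongr
        rw [ENNReal.div_le_iff (by simpa using hTd) ENNReal.ofReal_ne_top,
          ← ENNReal.ofReal_mul (by positivity), mul_assoc, ← mul_pow]
        refine (hcount T hT).trans (le_of_eq ?_)
        congr 3
        field_simp
    _ = ENNReal.ofReal (S.card * ((1 + 0) / (2 * R) + 0) ^ d) * volume (unitBall N) :=
        hlim.liminf_eq
    _ = S.card * volume (unitBall N) / ENNReal.ofReal ((2 * R) ^ d) := by
        rw [add_zero, add_zero, ENNReal.ofReal_mul (Nat.cast_nonneg _), ENNReal.ofReal_natCast,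
          one_div, inv_pow, ENNReal.ofReal_inv_of_pos (by positivity), div_eq_mul_inv]
        ring

/-- Averaging over translations: some ball of radius `r` covers at least the average proportion
of `E`. -/
theorem exists_closedBall_inter_ge (hN : ∀ x, N x = 0 → x = 0) {E W : Set (Fin d → ℝ)} {r : ℝ}
    (hr : 0 < r) (hE : MeasurableSet E) (hEfin : volume E ≠ ∞) (hW : MeasurableSet W)
    (hW0 : volume W ≠ 0) (hEW : ∀ e ∈ E, N.closedBall e r ⊆ W) :
    ∃ x, ENNReal.ofReal (r ^ d) * volume (unitBall N) / volume W * volume E ≤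
      volume (E ∩ N.closedBall x r) := by
  have hcl : MeasurableSet {p : (Fin d → ℝ) × (Fin d → ℝ) | N (p.2 - p.1) ≤ r} :=
    (isClosed_Iic.preimage (N.continuous_pi.comp
      (continuous_snd.sub continuous_fst))).measurableSet
  have hswap : ∫⁻ x in W, volume (E ∩ N.closedBall x r) =
      ENNReal.ofReal (r ^ d) * volume (unitBall N) * volume E := by
    have h1 : ∀ x, volume (E ∩ N.closedBall x r) = ∫⁻ e in E,
        {p : (Fin d → ℝ) × (Fin d → ℝ) | N (p.2 - p.1) ≤ r}.indicator 1 (x, e) := fun x => by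
      have hm := (N.isClosed_closedBall_pi x r).measurableSet
      rw [Set.inter_comm, ← Measure.restrict_apply hm, ← lintegral_indicator_one hm]
      rfl
    simp_rw [h1]
    rw [lintegral_lintegral_swap (f := fun x e => {p : (Fin d → ℝ) × (Fin d → ℝ) |
      N (p.2 - p.1) ≤ r}.indicator 1 (x, e)) (measurable_one.indicator hcl).aemeasurable]
    have h2 : ∀ e ∈ E, ∫⁻ x in W, {p : (Fin d → ℝ) × (Fin d → ℝ) | N (p.2 - p.1) ≤ r}.indicator
        (1 : (Fin d → ℝ) × (Fin d → ℝ) → ℝ≥0∞) (x, e) =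
          ENNReal.ofReal (r ^ d) * volume (unitBall N) := fun e he => by
      have hm := (N.isClosed_closedBall_pi e r).measurableSet
      rw [← N.volume_closedBall e hr, ← Set.inter_eq_left.2 (hEW e he),
        ← Measure.restrict_apply hm, ← lintegral_indicator_one hm]
      refine lintegral_congr fun x => ?_
      simp only [Set.indicator, Seminorm.mem_closedBall, Set.mem_ofPred_eq, map_sub_rev N e x,
        Pi.one_apply]
    rw [setLIntegral_congr_fun hE h2, setLIntegral_const]
  obtain ⟨x, -, hx⟩ := exists_setLAverage_le hW0 hW.nullMeasurableSet (by
    rw [hswap]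
    exact ENNReal.mul_ne_top (ENNReal.mul_ne_top ENNReal.ofReal_ne_top
      (volume_unitBall_lt_top hN).ne) hEfin)
  refine ⟨x, le_trans (le_of_eq ?_) hx⟩
  rw [setLAverage_eq, hswap, ← ENNReal.mul_div_right_comm]

/-- Choosing balls greedily, the uncovered volume decays geometrically. -/
theorem exists_greedy_cover (hN : ∀ x, N x = 0 → x = 0) {E W : Set (Fin d → ℝ)} {r : ℝ}
    (hr : 0 < r) (hE : MeasurableSet E) (hEfin : volume E ≠ ∞) (hW : MeasurableSet W)
    (hW0 : volume W ≠ 0) (hEW : ∀ e ∈ E, N.closedBall e r ⊆ W) (M : ℕ) :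
    ∃ F : Finset (Fin d → ℝ), F.card ≤ M ∧ volume (E \ ⋃ x ∈ F, N.closedBall x r) ≤
      (1 - ENNReal.ofReal (r ^ d) * volume (unitBall N) / volume W) ^ M * volume E := by
  classical
  induction M with
  | zero => exact ⟨∅, by simp, by simp⟩
  | succ M ih =>
    obtain ⟨F, hF, hFE⟩ := ih
    set E' := E \ ⋃ x ∈ F, N.closedBall x r with hE'
    have hE'm : MeasurableSet E' := hE.diff (F.measurableSet_biUnion fun x _ =>
      (N.isClosed_closedBall_pi x r).measurableSet)
    have hE'fin : volume E' ≠ ∞ := ((measure_mono Set.sdiff_subset).trans_lt hEfin.lt_top).ne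
    obtain ⟨x, hx⟩ := exists_closedBall_inter_ge hN hr hE'm hE'fin hW hW0
      fun e he => hEW e he.1
    refine ⟨insert x F, (Finset.card_insert_le _ _).trans (by omega), ?_⟩
    have hset : E \ ⋃ y ∈ insert x F, N.closedBall y r = E' \ (E' ∩ N.closedBall x r) := by
      rw [Finset.set_biUnion_insert, Set.sdiff_self_inter, hE', Set.sdiff_sdiff, Set.union_comm]
    rw [hset, measure_sdiff Set.inter_subset_left
      (hE'm.inter (N.isClosed_closedBall_pi x r).measurableSet).nullMeasurableSet
      ((measure_mono Set.inter_subset_left).trans_lt hE'fin.lt_top).ne]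
    refine (tsub_le_tsub_left hx _).trans ?_
    rw [pow_succ', mul_assoc]
    refine le_trans (le_of_eq ?_) (mul_le_mul_right hFE _)
    rw [ENNReal.sub_mul fun _ _ => hE'fin, one_mul]

/-- Rogers' two-step construction in a cube of side `2 R`: greedily chosen balls of radius
`1 / (1 + η)`, followed by a maximal packing of balls of radius `η / (1 + η)` in what is left. -/
theorem coveringConstant_le_of_cube (hd : 1 ≤ d) {c : ℝ} (hc0 : 0 < c)
    (hc : ∀ x, ‖x‖ ≤ c * N x) {η : ℝ} (hη0 : 0 < η) (hη1 : η < 1) {R : ℝ} (hR : 0 < R) :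
    coveringConstant N ≤ ENNReal.ofReal (d * Real.log η⁻¹ * (1 + η) ^ d * (1 + 2 * c / R) ^ d +
      (volume (unitBall N)).toReal * (1 / 2 / R) ^ d + (1 + η) ^ d * (1 + c / R) ^ d) := by
  classical
  have hdR : (0 : ℝ) < d := by exact_mod_cast hd
  have hN : ∀ x, N x = 0 → x = 0 := fun x hx => by
    have := hc x
    rw [hx, mul_zero] at this
    exact norm_le_zero_iff.1 this
  have hvfin := (volume_unitBall_lt_top hN).ne
  set v := (volume (unitBall N)).toReal with hv
  have hv0 : 0 < v := ENNReal.toReal_pos (volume_unitBall_pos N).ne' hvfin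
  have hvE : volume (unitBall N) = ENNReal.ofReal v := (ENNReal.ofReal_toReal hvfin).symm
  set Q : ℝ → Set (Fin d → ℝ) := fun R => Set.Icc (fun _ => -R) fun _ => R with hQ
  have hQR : ∀ {r : ℝ}, 0 ≤ r → ∀ t, t ∈ Q r ↔ ‖t‖ ≤ r := fun hr t => mem_cube_iff_norm_le hr
  have hQvol : ∀ {r : ℝ}, 0 ≤ r → volume (Q r) = ENNReal.ofReal ((2 * r) ^ d) := fun hr => by
    rw [hQ, volume_Icc_cube, ENNReal.ofReal_pow (by positivity)]
  have hQball : ∀ {s : ℝ}, 0 ≤ s → ∀ e ∈ Q s, ∀ r ≤ 1, N.closedBall e r ⊆ Q (s + c) := by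
    intro s hs e he r hr y hy
    rw [Seminorm.mem_closedBall] at hy
    refine (hQR (by linarith) y).2 ?_
    have h1 : ‖y‖ ≤ ‖y - e‖ + ‖e‖ := by simpa using norm_add_le (y - e) e
    have h2 := (hQR hs e).1 he
    have h3 : ‖y - e‖ ≤ c := (hc _).trans (mul_le_of_le_one_right hc0.le (hy.trans hr))
    linarith
  set r := (1 + η)⁻¹ with hr
  set b := η * r with hb
  have hr0 : 0 < r := by positivity
  have hb0 : 0 < b := by positivity
  have hrb : r + b = 1 := by rw [hb, hr]; field_simp
  have hbr : b < r := by rw [hb]; nlinarith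
  set L₁ := (2 * (R + c)) ^ d with hL₁
  set L₂ := (2 * (R + c + c)) ^ d with hL₂
  have hL₁0 : 0 < L₁ := by positivity
  have hL₂0 : 0 < L₂ := by positivity
  set p := r ^ d * v / L₂ with hp
  have hp0 : 0 < p := by positivity
  set M := ⌈d * Real.log η⁻¹ / p⌉₊ with hM
  have hlog : 0 < Real.log η⁻¹ := Real.log_pos ((one_lt_inv₀ hη0).2 hη1)
  obtain ⟨F, hFM, hF⟩ := exists_greedy_cover hN (E := Q (R + c)) (W := Q (R + c + c)) hr0
    measurableSet_Icc (by rw [hQvol (by positivity)]; exact ENNReal.ofReal_ne_top)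
    measurableSet_Icc (by rw [hQvol (by positivity)]; simpa using hL₂0)
    (fun e he => hQball (by positivity) e he r (by linarith)) M
  have hFvol : volume (Q (R + c) \ ⋃ x ∈ F, N.closedBall x r) ≤
      ENNReal.ofReal (η ^ d * L₁) := by
    refine hF.trans ?_
    rw [hQvol (by positivity), hQvol (by positivity), hvE, ← ENNReal.ofReal_mul (by positivity),
      ← hL₁, ← hL₂, ← ENNReal.ofReal_div_of_pos hL₂0, ← hp, ← ENNReal.ofReal_one,
      ← ENNReal.ofReal_sub _ hp0.le, ENNReal.ofReal_mul (by positivity)]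
    gcongr
    have h1 : ENNReal.ofReal (1 - p) ≤ ENNReal.ofReal (Real.exp (-p)) :=
      ENNReal.ofReal_le_ofReal (by linarith [Real.add_one_le_exp (-p)])
    refine (pow_le_pow_left₀ zero_le h1 M).trans ?_
    rw [← ENNReal.ofReal_pow (Real.exp_pos _).le, ← Real.exp_nat_mul]
    refine ENNReal.ofReal_le_ofReal ?_
    have h2 : η ^ d = Real.exp (-(d * Real.log η⁻¹)) := by
      rw [Real.log_inv, mul_neg, neg_neg, Real.exp_nat_mul, Real.exp_log hη0]
    rw [h2]
    refine Real.exp_le_exp.2 ?_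
    have h3 := Nat.le_ceil (d * Real.log η⁻¹ / p)
    rw [← hM, div_le_iff₀ hp0] at h3
    linarith
  obtain ⟨S, hSA, hcov, hcard⟩ := exists_cover_card_mul_le (N := N)
    (A := Q R \ ⋃ x ∈ F, N.closedBall x 1) (W := Q (R + c) \ ⋃ x ∈ F, N.closedBall x r) hb0
    (fun x hx y hy => by
      refine ⟨hQball hR.le x hx.1 b (by linarith) hy, fun hyF => hx.2 ?_⟩
      obtain ⟨z, hz, hyz⟩ := Set.mem_iUnion₂.1 hyF
      refine Set.mem_iUnion₂.2 ⟨z, hz, ?_⟩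
      rw [Seminorm.mem_closedBall] at hy hyz ⊢
      have : N (x - z) ≤ N (y - x) + N (y - z) := by
        rw [map_sub_rev N y x, show x - z = (x - y) + (y - z) by abel]
        exact map_add_le_add N _ _
      linarith)
    (hFvol.trans_lt ENNReal.ofReal_lt_top).ne
  refine (coveringConstant_le_of_cover hN hR (S := F ∪ S) fun t ht => ?_).trans ?_
  · by_cases htF : t ∈ ⋃ x ∈ F, N.closedBall x 1
    · obtain ⟨z, hz, htz⟩ := Set.mem_iUnion₂.1 htF
      exact ⟨z, Finset.mem_union_left _ hz, htz⟩
    · obtain ⟨z, hz, htz⟩ := hcov t ⟨ht, htF⟩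
      exact ⟨z, Finset.mem_union_right _ hz, Seminorm.closedBall_mono (by linarith) htz⟩
  · have hRd : 0 < (2 * R) ^ d := by positivity
    have hS : (S.card : ℝ) * (b ^ d * v) ≤ η ^ d * L₁ := by
      have h := hcard.trans hFvol
      rwa [hvE, ← ENNReal.ofReal_natCast, ← ENNReal.ofReal_mul (pow_nonneg hb0.le d),
        ← ENNReal.ofReal_mul (Nat.cast_nonneg _),
        ENNReal.ofReal_le_ofReal_iff (by positivity)] at h
    have hFc : (F.card : ℝ) ≤ d * Real.log η⁻¹ / p + 1 := by
      have h1 := Nat.ceil_lt_add_one (show 0 ≤ d * Real.log η⁻¹ / p by positivity)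
      have h2 : (F.card : ℝ) ≤ M := by exact_mod_cast hFM
      linarith
    have hU : ((F ∪ S).card : ℝ) ≤ F.card + S.card := by exact_mod_cast Finset.card_union_le _ _
    rw [hvE, ← ENNReal.ofReal_natCast, ← ENNReal.ofReal_mul (Nat.cast_nonneg _),
      ← ENNReal.ofReal_div_of_pos hRd]
    refine ENNReal.ofReal_le_ofReal ?_
    have hS' : (S.card : ℝ) * v ≤ (1 + η) ^ d * L₁ := by
      have h1 : b ^ d = η ^ d / (1 + η) ^ d := by rw [hb, hr, ← div_eq_mul_inv, div_pow]
      have hηd : 0 < η ^ d := by positivity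
      have hηd' : 0 < (1 + η) ^ d := by positivity
      rw [h1, div_mul_eq_mul_div, ← mul_div_assoc, div_le_iff₀ hηd'] at hS
      nlinarith
    have hF' : (F.card : ℝ) * v ≤ d * Real.log η⁻¹ * (1 + η) ^ d * L₂ + v := by
      have h1 : (d * Real.log η⁻¹ / p + 1) * v = d * Real.log η⁻¹ * (1 + η) ^ d * L₂ + v := by
        rw [hp, hr, inv_pow]; field_simp
      rw [← h1]
      exact mul_le_mul_of_nonneg_right hFc hv0.le
    rw [div_le_iff₀ hRd]
    have e1 : (1 + 2 * c / R) ^ d * (2 * R) ^ d = L₂ := by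
      rw [← mul_pow, hL₂]; congr 1; field_simp; ring
    have e2 : (1 / 2 / R) ^ d * (2 * R) ^ d = 1 := by
      rw [← mul_pow, show 1 / 2 / R * (2 * R) = 1 by field_simp, one_pow]
    have e3 : (1 + c / R) ^ d * (2 * R) ^ d = L₁ := by
      rw [← mul_pow, hL₁]; congr 1; field_simp
    rw [add_mul, add_mul, mul_assoc _ _ ((2 * R) ^ d), mul_assoc v, mul_assoc _ _ ((2 * R) ^ d),
      e1, e2, e3]
    have := mul_le_mul_of_nonneg_right hU hv0.le
    linarith

/-- Rogers' bound, before the choice of `η`. -/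
theorem coveringConstant_le_of_lt_one (hd : 1 ≤ d) (hN : ∀ x, N x = 0 → x = 0) {η : ℝ}
    (hη0 : 0 < η) (hη1 : η < 1) :
    coveringConstant N ≤ ENNReal.ofReal ((1 + η) ^ d * (1 + d * Real.log η⁻¹)) := by
  obtain ⟨c, hc0, hc⟩ := Seminorm.exists_norm_le_mul hN
  have hcR : ∀ k : ℝ, Tendsto (fun R : ℝ => k / R) atTop (𝓝 0) := fun k =>
    tendsto_const_nhds.div_atTop tendsto_id
  have hlim := ((((((hcR (2 * c)).const_add 1).pow d).const_mul
    (d * Real.log η⁻¹ * (1 + η) ^ d)).add (((hcR (1 / 2)).pow d).const_mul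
    (volume (unitBall N)).toReal)).add ((((hcR c).const_add 1).pow d).const_mul ((1 + η) ^ d)))
  refine (ge_of_tendsto (ENNReal.tendsto_ofReal hlim) ?_).trans (le_of_eq ?_)
  · filter_upwards [eventually_gt_atTop 0] with R hR
    exact coveringConstant_le_of_cube hd hc0 hc hη0 hη1 hR
  · congr 1
    rw [zero_pow (by omega)]
    ring

theorem rogers_bound_two :
    (1 + 1 / 2 : ℝ) ^ 2 * (1 + 2 * Real.log (1 / 2 : ℝ)⁻¹) ≤
      2 * Real.log 2 + 2 * Real.log (Real.log 2) + 5 * 2 := by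
  have h1 := Real.log_two_gt_d9
  have h2 := Real.log_two_lt_d9
  have h3 := Real.one_sub_inv_le_log_of_pos (show 0 < Real.log 2 by linarith)
  have h4 : (Real.log 2)⁻¹ ≤ 2 := by
    rw [inv_le_comm₀ (by linarith) (by norm_num)]; linarith
  rw [one_div, inv_inv]
  norm_num
  linarith

theorem rogers_bound_of_three_le {n : ℕ} (hn : 3 ≤ n) :
    (1 + ((n : ℝ) * Real.log n)⁻¹) ^ n * (1 + n * Real.log (n * Real.log n)) ≤
      n * Real.log n + n * Real.log (Real.log n) + 5 * n := by
  have hn3 : (3 : ℝ) ≤ n := by exact_mod_cast hn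
  have hn0 : (0 : ℝ) < n := by linarith
  set l := Real.log n with hl
  have hl1 : 1 ≤ l := by
    rw [hl, Real.le_log_iff_exp_le hn0]
    linarith [Real.exp_one_lt_d9]
  have hl0 : 0 < l := by linarith
  set x := l⁻¹ with hx
  have hx0 : 0 < x := inv_pos.2 hl0
  have hx1 : x ≤ 1 := inv_le_one_of_one_le₀ hl1
  have hxl : x * l = 1 := inv_mul_cancel₀ hl0.ne'
  have hpow : (1 + ((n : ℝ) * l)⁻¹) ^ n ≤ 1 + x + x ^ 2 := by
    have h1 : 1 + ((n : ℝ) * l)⁻¹ ≤ Real.exp (((n : ℝ) * l)⁻¹) := by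
      linarith [Real.add_one_le_exp (((n : ℝ) * l)⁻¹)]
    have h2 : (1 + ((n : ℝ) * l)⁻¹) ^ n ≤ Real.exp x := by
      refine (pow_le_pow_left₀ (by positivity) h1 n).trans (le_of_eq ?_)
      rw [← Real.exp_nat_mul]
      congr 1
      rw [hx]; field_simp
    have h3 := (abs_le.1 (Real.abs_exp_sub_one_sub_id_le (x := x) (by rwa [abs_of_pos hx0]))).2
    linarith
  have hlog : Real.log (n * l) = l + Real.log l := Real.log_mul hn0.ne' hl0.ne'
  have hll : Real.log l ≤ l - 1 := Real.log_le_sub_one_of_pos hl0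
  have hll0 : 0 ≤ Real.log l := Real.log_nonneg hl1
  rw [hlog]
  have h1 : (1 + ((n : ℝ) * l)⁻¹) ^ n * (1 + n * (l + Real.log l)) ≤
      (1 + x + x ^ 2) * (1 + n * (l + Real.log l)) := by
    gcongr
  have h2 : (x + x ^ 2) * (l + Real.log l) ≤ 2 + x - x ^ 2 := by
    have : (x + x ^ 2) * (l + Real.log l) ≤ (x + x ^ 2) * (2 * l - 1) := by
      gcongr; linarith
    have e : (x + x ^ 2) * (2 * l - 1) = 2 * (x * l) + 2 * x * (x * l) - x - x ^ 2 := by ring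
    rw [hxl] at e
    linarith
  have h3 : (n : ℝ) * ((x + x ^ 2) * (l + Real.log l)) ≤ n * (2 + x - x ^ 2) := by gcongr
  nlinarith [mul_nonneg hn0.le (sq_nonneg (x - 1 / 2))]

theorem coveringConstant_le_rogers (hd : 2 ≤ d) (hN : ∀ x, N x = 0 → x = 0) :
    coveringConstant N ≤
      ENNReal.ofReal (d * Real.log d + d * Real.log (Real.log d) + 5 * d) := by
  rcases hd.eq_or_lt with rfl | hd3
  · refine (coveringConstant_le_of_lt_one (by omega) hN (η := 1 / 2) (by norm_num)
      (by norm_num)).trans (ENNReal.ofReal_le_ofReal ?_)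
    exact_mod_cast rogers_bound_two
  · have hn3 : (3 : ℝ) ≤ d := by exact_mod_cast hd3
    have hl1 : 1 ≤ Real.log d := by
      rw [Real.le_log_iff_exp_le (by linarith)]
      linarith [Real.exp_one_lt_d9]
    have hbig : 1 < (d : ℝ) * Real.log d := by nlinarith
    refine (coveringConstant_le_of_lt_one (by omega) hN (η := ((d : ℝ) * Real.log d)⁻¹)
      (by positivity) (inv_lt_one_of_one_lt₀ hbig)).trans (ENNReal.ofReal_le_ofReal ?_)
    rw [inv_inv]
    exact rogers_bound_of_three_le hd3

end Rogers

/-! ### The infimum over all domains -/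

section Domains

variable {d : ℕ} {N : Seminorm ℝ (Fin d → ℝ)}

theorem le_optErrInt_mul (hd : 1 ≤ d) (hN : ∀ x, N x = 0 → x = 0) {D : Set (Fin d → ℝ)}
    (hD : IsJordanDomain D) {n : ℕ} (hn : 1 ≤ n) :
    (d : ℝ≥0∞) / (d + 1) * volume (unitBall N) ^ (-(1 / (d : ℝ))) *
        (n : ℝ≥0∞) ^ (-(1 / (d : ℝ))) ≤
      optErrInt N D n * volume D ^ (-(((d : ℝ) + 1) / d)) := by
  have hdR : (0 : ℝ) < d := by exact_mod_cast hd
  have hn0 : (0 : ℝ) < n := by exact_mod_cast hn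
  have hvfin := (volume_unitBall_lt_top hN).ne
  set v := (volume (unitBall N)).toReal with hv
  have hv0 : 0 < v := ENNReal.toReal_pos (volume_unitBall_pos N).ne' hvfin
  have hvE : volume (unitBall N) = ENNReal.ofReal v := (ENNReal.ofReal_toReal hvfin).symm
  have hDfin := hD.1.volume_lt_top
  set a := (volume D).toReal with ha
  have ha0 : 0 < a := ENNReal.toReal_pos hD.volume_pos.ne' hDfin.ne
  have haE : volume D = ENNReal.ofReal a := (ENNReal.ofReal_toReal hDfin.ne).symm
  set ρ : ℝ := (a / (n * v)) ^ (1 / (d : ℝ)) with hρ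
  have hρ0 : 0 < ρ := by positivity
  have hρd : ρ ^ d = a / (n * v) := by
    rw [hρ, ← Real.rpow_natCast, ← Real.rpow_mul (by positivity), one_div_mul_cancel hdR.ne',
      Real.rpow_one]
  have h := le_minCost (N := N) hDfin.ne (n := n) hρ0 (by
    rw [haE, hvE, ← ENNReal.ofReal_natCast, ← ENNReal.ofReal_mul (by positivity),
      ← ENNReal.ofReal_mul (by positivity), hρd]
    congr 1; field_simp)
  rw [optErrInt_eq_minCost hD hn]
  refine le_trans (le_of_eq ?_) (mul_le_mul_left h _)
  rw [haE, hvE, ENNReal.ofReal_rpow_of_pos ha0, ENNReal.ofReal_rpow_of_pos hv0,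
    ← ENNReal.ofReal_natCast n, ENNReal.ofReal_rpow_of_pos hn0, ← ENNReal.ofReal_natCast d,
    ← ENNReal.ofReal_one, ← ENNReal.ofReal_add hdR.le zero_le_one,
    ← ENNReal.ofReal_div_of_pos (by positivity), ← ENNReal.ofReal_mul (by positivity),
    ← ENNReal.ofReal_mul (by positivity), ← ENNReal.ofReal_mul (by positivity),
    ← ENNReal.ofReal_mul (by positivity)]
  congr 1
  have e1 : a * a ^ (-(((d : ℝ) + 1) / d)) = (a ^ (1 / (d : ℝ)))⁻¹ := by
    rw [← Real.rpow_neg ha0.le]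
    nth_rewrite 1 [← Real.rpow_one a]
    rw [← Real.rpow_add ha0]
    congr 1; field_simp; ring
  rw [mul_assoc _ a, e1, hρ, Real.div_rpow ha0.le (by positivity), Real.mul_rpow hn0.le hv0.le,
    Real.rpow_neg hv0.le, Real.rpow_neg hn0.le]
  field_simp

/-- The disjoint union of `n` balls attains the infimum. -/
theorem exists_optErrInt_mul_le (hd : 1 ≤ d) (hN : ∀ x, N x = 0 → x = 0) {n : ℕ} (hn : 1 ≤ n) :
    ∃ D : Set (Fin d → ℝ), IsJordanDomain D ∧
      optErrInt N D n * volume D ^ (-(((d : ℝ) + 1) / d)) ≤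
        (d : ℝ≥0∞) / (d + 1) * volume (unitBall N) ^ (-(1 / (d : ℝ))) *
          (n : ℝ≥0∞) ^ (-(1 / (d : ℝ))) := by
  classical
  have hdR : (0 : ℝ) < d := by exact_mod_cast hd
  have hn0 : (0 : ℝ) < n := by exact_mod_cast hn
  have hvfin := (volume_unitBall_lt_top hN).ne
  set v := (volume (unitBall N)).toReal with hv
  have hv0 : 0 < v := ENNReal.toReal_pos (volume_unitBall_pos N).ne' hvfin
  have hvE : volume (unitBall N) = ENNReal.ofReal v := (ENNReal.ofReal_toReal hvfin).symm
  obtain ⟨c, hc0, hc⟩ := Seminorm.exists_norm_le_mul hN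
  have hball : ∀ x t, t ∈ N.closedBall x 1 → ‖t - x‖ ≤ c := fun x t ht =>
    (hc _).trans (mul_le_of_le_one_right hc0.le ht)
  -- centres on a diagonal line, further apart than the diameter `2 * c` of the balls
  let p : ℕ → (Fin d → ℝ) := fun k _ => 3 * c * k
  have hpdist : ∀ k l : ℕ, k ≠ l → 3 * c ≤ ‖p k - p l‖ := fun k l hkl => by
    refine le_trans ?_ (norm_le_pi_norm (p k - p l) ⟨0, hd⟩)
    have h1 : (1 : ℝ) ≤ |(k : ℝ) - l| := by
      have : (1 : ℤ) ≤ |(k : ℤ) - l| := Int.one_le_abs (sub_ne_zero.2 (by exact_mod_cast hkl))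
      exact_mod_cast this
    simp only [p, Pi.sub_apply, Real.norm_eq_abs]
    rw [← mul_sub, abs_mul, abs_of_pos (by positivity)]
    exact le_mul_of_one_le_right (by positivity) h1
  set D : Set (Fin d → ℝ) := ⋃ k ∈ Finset.range n, N.closedBall (p k) 1 with hDdef
  have hfr : ∀ x, volume (frontier (N.closedBall x 1)) = 0 := fun x =>
    (N.convex_closedBall x 1).addHaar_frontier volume
  have hDm : IsJordanMeasurable D := by
    refine ⟨(Bornology.isBounded_biUnion_finset _).2 fun k _ =>
      Seminorm.isBounded_closedBall hN _ _, ?_⟩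
    have hsub : frontier D ⊆ ⋃ k ∈ Finset.range n, frontier (N.closedBall (p k) 1) := by
      have hcl : IsClosed D := isClosed_biUnion_finset fun k _ => N.isClosed_closedBall_pi _ _
      intro t ht
      obtain ⟨k, hk, htk⟩ := Set.mem_iUnion₂.1 (hcl.frontier_subset ht)
      exact Set.mem_iUnion₂.2 ⟨k, hk, subset_closure htk, fun hti =>
        ht.2 (interior_mono (fun s hs => Set.mem_iUnion₂.2 ⟨k, hk, hs⟩) hti)⟩
    exact measure_mono_null hsub ((measure_biUnion_null_iff (Finset.countable_toSet _)).2
      fun k _ => hfr _)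
  have hD : IsJordanDomain D := by
    refine ⟨hDm, ⟨p 0, mem_interior.2 ⟨{t | N (t - p 0) < 1}, fun t ht => ?_, ?_, by simp⟩⟩⟩
    · exact Set.mem_iUnion₂.2 ⟨0, Finset.mem_range.2 hn, (show N (t - p 0) < 1 from ht).le⟩
    · exact isOpen_Iio.preimage (N.continuous_pi.comp (continuous_id.sub continuous_const))
  have hvol : volume D = ENNReal.ofReal (n * v) := by
    rw [hDdef, measure_biUnion_finset (fun k _ l _ hkl => ?_)
      fun k _ => (N.isClosed_closedBall_pi _ _).measurableSet]
    · simp [N.volume_closedBall _ one_pos, hvE, ENNReal.ofReal_mul hn0.le]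
    · rw [Function.onFun, Set.disjoint_left]
      intro t hk hl
      have h1 := hball _ _ hk
      have h2 := hball _ _ hl
      have h3 := hpdist k l hkl
      have h4 : ‖p k - p l‖ ≤ ‖t - p k‖ + ‖t - p l‖ := by
        rw [norm_sub_rev t (p k)]
        simpa using norm_add_le (p k - t) (t - p l)
      linarith
  have hcost : optErrInt N D n ≤ ENNReal.ofReal (n * ((d : ℝ) / (d + 1) * v)) := by
    rw [optErrInt_eq_minCost hD hn]
    have h1 := minCost_biUnion_le (N := N) (Finset.range n) (fun k => N.closedBall (p k) 1) 1
    rw [Finset.card_range, mul_one] at h1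
    refine h1.trans ((Finset.sum_le_sum (g := fun _ => ENNReal.ofReal ((d : ℝ) / (d + 1) * v))
      fun k _ => ?_).trans (le_of_eq ?_))
    · have h2 := nodeCost_le_of_cover (N.convex_closedBall (p k) 1)
        (N.isClosed_closedBall_pi (p k) 1).measurableSet
        (Seminorm.isBounded_closedBall hN _ _).measure_lt_top.ne (S := {p k}) (by simp)
        (Finset.singleton_nonempty _) one_pos fun t ht => ⟨p k, Finset.mem_singleton_self _, ht⟩
      refine (minCost_le (S := {p k}) (by simp) (by simp)).trans (h2.trans ?_)
      rw [N.volume_closedBall _ one_pos, hvE, one_pow, ENNReal.ofReal_one, one_mul, mul_one,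
        ← ENNReal.ofReal_mul (by positivity)]
    · rw [Finset.sum_const, Finset.card_range, nsmul_eq_mul, ENNReal.ofReal_mul hn0.le,
        ENNReal.ofReal_natCast]
  refine ⟨D, hD, (mul_le_mul_left hcost _).trans (le_of_eq ?_)⟩
  have hnv : 0 < (n : ℝ) * v := by positivity
  rw [hvol, hvE, ENNReal.ofReal_rpow_of_pos hnv, ENNReal.ofReal_rpow_of_pos hv0,
    ← ENNReal.ofReal_natCast n, ENNReal.ofReal_rpow_of_pos hn0, ← ENNReal.ofReal_natCast d,
    ← ENNReal.ofReal_one, ← ENNReal.ofReal_add hdR.le zero_le_one,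
    ← ENNReal.ofReal_div_of_pos (by positivity), ← ENNReal.ofReal_mul (by positivity),
    ← ENNReal.ofReal_mul (by positivity), ← ENNReal.ofReal_mul (by positivity)]
  congr 1
  have e1 : (n * v) * (n * v) ^ (-(((d : ℝ) + 1) / d)) = (n * v) ^ (-(1 / (d : ℝ))) := by
    nth_rewrite 1 [← Real.rpow_one (n * v)]
    rw [← Real.rpow_add hnv]
    congr 1; field_simp; ring
  rw [show (n : ℝ) * ((d : ℝ) / (d + 1) * v) * (n * v) ^ (-(((d : ℝ) + 1) / d)) =
    (d : ℝ) / (d + 1) * ((n * v) * (n * v) ^ (-(((d : ℝ) + 1) / d))) by ring, e1,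
    Real.mul_rpow hn0.le hv0.le]
  ring

end Domains

/-! ### The constant `ξ` and the limit for `optErrInt` -/

section Constant

variable {d : ℕ} {N : Seminorm ℝ (Fin d → ℝ)}

theorem cubeConst_mul_le_coveringConstant (hd : 1 ≤ d) (hN : ∀ x, N x = 0 → x = 0) :
    ENNReal.ofReal (cubeConst N * (volume (unitBall N)).toReal ^ (1 / (d : ℝ))) ≤
      (d : ℝ≥0∞) / (d + 1) * coveringConstant N ^ (1 / (d : ℝ)) := by
  have hdR : (0 : ℝ) < d := by exact_mod_cast hd
  have hdE : (d : ℝ≥0∞) / (d + 1) = ENNReal.ofReal ((d : ℝ) / (d + 1)) := by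
    rw [ENNReal.ofReal_div_of_pos (by positivity), ENNReal.ofReal_add hdR.le zero_le_one,
      ENNReal.ofReal_natCast, ENNReal.ofReal_one]
  have hcpos : (0 : ℝ) < (d : ℝ) / (d + 1) := by positivity
  rcases eq_or_ne (coveringConstant N) ∞ with htop | htop
  · rw [htop, ENNReal.top_rpow_of_pos (by positivity), hdE, ENNReal.mul_top (by simpa using hcpos)]
    exact le_top
  set t := (coveringConstant N).toReal with ht
  have htE : coveringConstant N = ENNReal.ofReal t := (ENNReal.ofReal_toReal htop).symm
  have ht0 : 0 ≤ t := ENNReal.toReal_nonneg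
  have hθ : ∀ θ > t, cubeConst N * (volume (unitBall N)).toReal ^ (1 / (d : ℝ)) ≤
      (d : ℝ) / (d + 1) * θ ^ (1 / (d : ℝ)) := fun θ h => by
    have hlt : coveringConstant N < ENNReal.ofReal θ := by
      rw [htE]; exact (ENNReal.ofReal_lt_ofReal_iff (ht0.trans_lt h)).2 h
    simp only [coveringConstant, iInf_lt_iff] at hlt
    obtain ⟨X, hX, hXθ⟩ := hlt
    exact cubeConst_le_of_systemDensity_lt hd hN hX (ht0.trans h.le) hXθ
  have hcont : Continuous fun θ : ℝ => (d : ℝ) / (d + 1) * θ ^ (1 / (d : ℝ)) :=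
    continuous_const.mul (Real.continuous_rpow_const (by positivity))
  have hle : cubeConst N * (volume (unitBall N)).toReal ^ (1 / (d : ℝ)) ≤
      (d : ℝ) / (d + 1) * t ^ (1 / (d : ℝ)) :=
    ge_of_tendsto ((hcont.tendsto t).mono_left nhdsWithin_le_nhds)
      (eventually_nhdsWithin_of_forall (s := Set.Ioi t) hθ)
  rw [htE, hdE, ENNReal.ofReal_rpow_of_nonneg ht0 (by positivity),
    ← ENNReal.ofReal_mul hcpos.le]
  exact ENNReal.ofReal_le_ofReal hle

theorem tendsto_optErrInt_div (hd : 1 ≤ d) (hN : ∀ x, N x = 0 → x = 0) {D : Set (Fin d → ℝ)}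
    (hD : IsJordanDomain D) :
    Tendsto (fun n : ℕ => optErrInt N D n /
        (ENNReal.ofReal (cubeConst N * (volume (unitBall N)).toReal ^ (1 / (d : ℝ))) * volume D *
          (volume D / volume (unitBall N)) ^ (1 / (d : ℝ)) * (n : ℝ≥0∞) ^ (-(1 / (d : ℝ)))))
      atTop (𝓝 1) := by
  have hdR : (0 : ℝ) < d := by exact_mod_cast hd
  have hvfin := (volume_unitBall_lt_top hN).ne
  have hlow := le_cubeConst hd hN
  set v := (volume (unitBall N)).toReal with hv
  have hv0 : 0 < v := ENNReal.toReal_pos (volume_unitBall_pos N).ne' hvfin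
  have hvE : volume (unitBall N) = ENNReal.ofReal v := (ENNReal.ofReal_toReal hvfin).symm
  have hDfin := hD.1.volume_lt_top
  have hlim := tendsto_minCost hd hN hD
  set a := (volume D).toReal with ha
  have ha0 : 0 < a := ENNReal.toReal_pos hD.volume_pos.ne' hDfin.ne
  have haE : volume D = ENNReal.ofReal a := (ENNReal.ofReal_toReal hDfin.ne).symm
  have hvp : 0 < v ^ (1 / (d : ℝ)) := by positivity
  have hκ : 0 < cubeConst N := by
    have : 0 < cubeConst N * v ^ (1 / (d : ℝ)) := lt_of_lt_of_le (by positivity) hlow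
    exact pos_of_mul_pos_left this hvp.le
  set κ := cubeConst N
  have hlimit : 0 < κ * a ^ (1 + 1 / (d : ℝ)) := by positivity
  have h1 := ENNReal.tendsto_ofReal (hlim.div_const (κ * a ^ (1 + 1 / (d : ℝ))))
  rw [div_self hlimit.ne', ENNReal.ofReal_one] at h1
  refine h1.congr' ?_
  filter_upwards [eventually_ge_atTop 1] with n hn
  have hn0 : (0 : ℝ) < n := by exact_mod_cast hn
  have hfin : minCost N D n ≠ ∞ := minCost_ne_top hD.1.1 hD.nonempty hn
  have hnp : 0 < (n : ℝ) ^ (-(1 / (d : ℝ))) := by positivity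
  rw [optErrInt_eq_minCost hD hn, haE, hvE, ← ENNReal.ofReal_div_of_pos hv0,
    ENNReal.ofReal_rpow_of_pos (by positivity), ← ENNReal.ofReal_natCast n,
    ENNReal.ofReal_rpow_of_pos hn0, ← ENNReal.ofReal_mul (by positivity),
    ← ENNReal.ofReal_mul (by positivity), ← ENNReal.ofReal_mul (by positivity),
    ← ENNReal.ofReal_toReal hfin, ← ENNReal.ofReal_div_of_pos (by positivity),
    ENNReal.toReal_ofReal ENNReal.toReal_nonneg, div_div]
  congr 2
  rw [Real.div_rpow ha0.le hv0.le, Real.rpow_add ha0, Real.rpow_one]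
  field_simp

end Constant

theorem theorem2 (d : ℕ) (hd : 1 ≤ d) (N : Seminorm ℝ (Fin d → ℝ))
    (hN : ∀ x, N x = 0 → x = 0) :
    (∃ ξ : ℝ≥0,
      (∀ D : Set (Fin d → ℝ), IsJordanDomain D →
        Tendsto (fun n : ℕ => optErrInt N D n /
            ((ξ : ℝ≥0∞) * volume D * (volume D / volume (unitBall N)) ^ (1 / (d : ℝ)) *
              (n : ℝ≥0∞) ^ (-(1 / (d : ℝ)))))
          atTop (𝓝 1)) ∧
      (d : ℝ≥0∞) / (d + 1) ≤ ξ ∧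
      (ξ : ℝ≥0∞) ≤ (d : ℝ≥0∞) / (d + 1) * coveringConstant N ^ (1 / (d : ℝ))) ∧
    (2 ≤ d →
      (d : ℝ≥0∞) / (d + 1) * coveringConstant N ^ (1 / (d : ℝ)) ≤
        ENNReal.ofReal ((d : ℝ) / (d + 1) *
          (d * Real.log d + d * Real.log (Real.log d) + 5 * d) ^ (1 / (d : ℝ)))) ∧
    (∀ n : ℕ, 1 ≤ n →
      ⨅ D ∈ {D : Set (Fin d → ℝ) | IsJordanDomain D},
          optErrInt N D n * volume D ^ (-(((d : ℝ) + 1) / d)) =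
        (d : ℝ≥0∞) / (d + 1) * volume (unitBall N) ^ (-(1 / (d : ℝ))) *
          (n : ℝ≥0∞) ^ (-(1 / (d : ℝ)))) := by
  have hdR : (0 : ℝ) < d := by exact_mod_cast hd
  have hdE : (d : ℝ≥0∞) / (d + 1) = ENNReal.ofReal ((d : ℝ) / (d + 1)) := by
    rw [ENNReal.ofReal_div_of_pos (by positivity), ENNReal.ofReal_add hdR.le zero_le_one,
      ENNReal.ofReal_natCast, ENNReal.ofReal_one]
  refine ⟨⟨Real.toNNReal (cubeConst N * (volume (unitBall N)).toReal ^ (1 / (d : ℝ))),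
    fun D hD => tendsto_optErrInt_div hd hN hD, ?_, cubeConst_mul_le_coveringConstant hd hN⟩,
    fun hd2 => ?_, fun n hn => le_antisymm ?_ ?_⟩
  · rw [hdE]
    exact ENNReal.ofReal_le_ofReal (le_cubeConst hd hN)
  · have hd2R : (2 : ℝ) ≤ d := by exact_mod_cast hd2
    have hl : 1 / 2 ≤ Real.log d :=
      (by linarith [Real.log_two_gt_d9] : 1 / 2 ≤ Real.log 2).trans
        (Real.log_le_log (by norm_num) hd2R)
    have hll := Real.one_sub_inv_le_log_of_pos (show 0 < Real.log d by linarith)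
    have hinv : (Real.log d)⁻¹ ≤ 2 := by
      rw [inv_le_comm₀ (by linarith) (by norm_num)]; linarith
    have hnn : 0 ≤ d * Real.log d + d * Real.log (Real.log d) + 5 * d := by nlinarith
    rw [ENNReal.ofReal_mul (by positivity), ← hdE,
      ← ENNReal.ofReal_rpow_of_nonneg hnn (by positivity)]
    gcongr
    exact coveringConstant_le_rogers hd2 hN
  · obtain ⟨D, hD, hle⟩ := exists_optErrInt_mul_le hd hN hn
    exact (iInf₂_le D hD).trans hle
  · exact le_iInf₂ fun D hD => le_optErrInt_mul hd hN hD hn
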